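/- Put $$A=\frac{2}{\sqrt{\pi}}+\sqrt{\frac{4}{\pi}+\frac32}=2.79368\ldots,\qquad \widehat{A_3}=2^{3/4}\,(4+2\sqrt2)=11.48399\ldots$$ (the constants of the explicit van der Corput second and third derivative tests). Let $\sigma,t$ be real numbers, $s=\sigma+it$ and $\tau=t/2\pi$. If $\tau>20$ and $\sigma\ge1$, then $$\begin{aligned}\Bigl|\zeta(s)-\sum_{1\le n\le \tau^{1/2}}\frac{1}{n^s}\Bigr|\le{}& \frac{\widehat{A_3}\,2^{\sigma-\frac12}}{2^{\sigma-\frac12}-1}\,\tau^{\frac12(\frac56-\sigma)}+ \frac{2^{\sigma+1}A}{1-2^{-\sigma}}\,\tau^{\frac23(\frac34-\sigma)}+ \frac{2^{\sigma+3}A}{3\log 2}\,\tau^{\frac23(\frac14-\sigma)}\log\tau\\ &+2^{\sigma+1}A\,\tau^{\frac23(\frac14-\sigma)}+8\,\tau^{1-2\sigma}.\end{aligned}$$ -/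

import Mathlib

/-- The constant `A = 2.79368...` of the explicit van der Corput second derivative test: the
positive root of `A ^ 2 = (4 / √π) * A + 3 / 2`. -/
noncomputable def vanDerCorputA : ℝ :=
  2 / √Real.pi + √(4 / Real.pi + 3 / 2)

/-- The constant `Â₃ = 2 ^ (3/4) * (4 + 2 * √2) = 11.48399...` of the explicit van der Corput
third derivative test for the zeta sums `∑ n ^ (-it)` over dyadic intervals. -/
noncomputable def vanDerCorputAHat3 : ℝ :=
  (2 : ℝ) ^ (3 / 4 : ℝ) * (4 + 2 * √2)

/-! Write `n ^ (-s)` as `n ^ (-σ)` times `e(-τ log n)`. Comparing the sum with an integral on unit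
intervals shows that the partial sum up to `τ ^ 2` approximates `ζ(s)` within `8 τ ^ (1 - 2σ)`
(`norm_riemannZeta_sub_sum_floor_le`). It remains to bound the terms between `τ ^ (1/2)` and `τ ^
2`, which is done on dyadic blocks, with Abel's inequality removing the weight `n ^ (-σ)`.

Beyond `τ ^ (2/3)` a second derivative test suffices. Terms whose phase increment is near an integer
are counted trivially, and the others form runs controlled by Kuzmin–Landau
(`norm_sum_phase_le_of_param`). Up to `τ ^ (2/3)`, the Weyl–van der Corput inequality first
differences the phase, and the same test is applied to the correlations
(`norm_sum_phase_log_le_third`).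

Everything is phrased with finite differences of the sequence, so no derivatives of the phase occur.
The block constants obtained, 11.4 and `4 * vanDerCorputA`, fit below those of the theorem because
`vanDerCorputAHat3 ≥ 11.4` and `2 ^ (σ + 1) ≥ 4`. -/

/-! ### The additive character and the Kuzmin–Landau inequality. -/

/-- The additive character `e(x) = exp(2πix)`. -/
noncomputable def phase (x : ℝ) : ℂ := Complex.exp ((2 * Real.pi * x : ℝ) * Complex.I)

lemma norm_phase (x : ℝ) : ‖phase x‖ = 1 := Complex.norm_exp_ofReal_mul_I _

lemma phase_add (x y : ℝ) : phase (x + y) = phase x * phase y := by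
  unfold phase
  rw [← Complex.exp_add]
  push_cast
  ring_nf

lemma phase_neg (x : ℝ) : phase (-x) = (starRingEnd ℂ) (phase x) := by
  unfold phase
  rw [← Complex.exp_conj, map_mul, Complex.conj_ofReal, Complex.conj_I]
  push_cast
  ring_nf

lemma phase_intCast (k : ℤ) : phase k = 1 := by
  unfold phase
  rw [Complex.exp_eq_one_iff]
  exact ⟨k, by push_cast; ring⟩

lemma phase_sub_int_mul (x : ℝ) (k : ℤ) (n : ℕ) : phase (x - k * n) = phase x := by
  have h : phase (x - k * n) = phase x * phase ((-(k * n) : ℤ) : ℝ) := by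
    rw [← phase_add]
    push_cast
    ring_nf
  rw [h, phase_intCast, mul_one]

/-- The coefficient `1 / (1 - e(d)) = (1 + i cot πd) / 2`. -/
noncomputable def phaseCoeff (d : ℝ) : ℂ :=
  (1 + (Real.cos (Real.pi * d) / Real.sin (Real.pi * d) : ℝ) * Complex.I) / 2

lemma phaseCoeff_mul {d : ℝ} (hd : Real.sin (Real.pi * d) ≠ 0) :
    phaseCoeff d * (1 - phase d) = 1 := by
  have h1 : phase d = ((1 - 2 * Real.sin (Real.pi * d) ^ 2 : ℝ) : ℂ)
      + ((2 * Real.sin (Real.pi * d) * Real.cos (Real.pi * d) : ℝ) : ℂ) * Complex.I := by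
    unfold phase
    rw [Complex.exp_mul_I, ← Complex.ofReal_cos, ← Complex.ofReal_sin,
      show 2 * Real.pi * d = 2 * (Real.pi * d) by ring, Real.cos_two_mul, Real.sin_two_mul,
      Real.cos_sq', show 2 * (1 - Real.sin (Real.pi * d) ^ 2) - 1
        = 1 - 2 * Real.sin (Real.pi * d) ^ 2 by ring]
  have h2 := Real.sin_sq_add_cos_sq (Real.pi * d)
  rw [h1]
  unfold phaseCoeff
  obtain ⟨k, hk⟩ : ∃ k, Real.cos (Real.pi * d) / Real.sin (Real.pi * d) = k := ⟨_, rfl⟩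
  rw [hk]
  rw [div_eq_iff hd] at hk
  rw [hk] at h2 ⊢
  have h3 := congrArg (fun y : ℝ => (y : ℂ)) h2
  push_cast at h3 ⊢
  linear_combination h3 - (k : ℂ) ^ 2 * (Complex.sin (Real.pi * d)) ^ 2 * Complex.I_sq

lemma norm_phaseCoeff {d : ℝ} (hd : 0 < Real.sin (Real.pi * d)) :
    ‖phaseCoeff d‖ = 1 / (2 * Real.sin (Real.pi * d)) := by
  have h2 := Real.sin_sq_add_cos_sq (Real.pi * d)
  have h3 : Complex.normSq (phaseCoeff d) = (1 / (2 * Real.sin (Real.pi * d))) ^ 2 := by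
    unfold phaseCoeff
    generalize Real.sin (Real.pi * d) = s at *
    generalize Real.cos (Real.pi * d) = c at *
    rw [Complex.normSq_apply]
    simp [-Complex.ofReal_div]
    field_simp
    linear_combination h2
  rw [Complex.norm_def, h3, Real.sqrt_sq (by positivity)]

/-- The coefficients lie on the line `Re = 1/2` with imaginary part `cot(πd) / 2`, which is monotone
on `(0, 1)`. Hence their total variation along monotone increments telescopes. -/
lemma norm_phaseCoeff_sub {d d' : ℝ} (hd : 0 < d) (hdd : d ≤ d') (hd' : d' < 1) :
    ‖phaseCoeff d' - phaseCoeff d‖ = (Real.cos (Real.pi * d) / Real.sin (Real.pi * d)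
      - Real.cos (Real.pi * d') / Real.sin (Real.pi * d')) / 2 := by
  have hp := Real.pi_pos
  have hs : 0 < Real.sin (Real.pi * d) :=
    Real.sin_pos_of_pos_of_lt_pi (by positivity) (by nlinarith)
  have hs' : 0 < Real.sin (Real.pi * d') :=
    Real.sin_pos_of_pos_of_lt_pi (by nlinarith) (by nlinarith)
  have h0 : 0 ≤ Real.sin (Real.pi * d' - Real.pi * d) :=
    Real.sin_nonneg_of_nonneg_of_le_pi (by nlinarith) (by nlinarith)
  rw [Real.sin_sub] at h0
  have h : phaseCoeff d' - phaseCoeff d = ((-((Real.cos (Real.pi * d) / Real.sin (Real.pi * d)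
      - Real.cos (Real.pi * d') / Real.sin (Real.pi * d')) / 2) : ℝ) : ℂ) * Complex.I := by
    unfold phaseCoeff
    push_cast
    ring
  rw [h, norm_mul, Complex.norm_I, mul_one, Complex.norm_real, norm_neg, Real.norm_of_nonneg]
  rw [div_sub_div _ _ hs.ne' hs'.ne']
  apply div_nonneg (div_nonneg _ (by positivity)) (by norm_num)
  linarith

/-- `1 / sin x + cot x = cot (x / 2) ≤ 2 / x`. -/
lemma one_add_cos_div_sin_le {x : ℝ} (hx : 0 < x) (hx' : x < Real.pi) :
    (1 + Real.cos x) / Real.sin x ≤ 2 / x := by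
  have hs : 0 < Real.sin (x / 2) := Real.sin_pos_of_pos_of_lt_pi (by linarith) (by linarith)
  have hc : 0 < Real.cos (x / 2) :=
    Real.cos_pos_of_mem_Ioo ⟨by linarith [Real.pi_pos], by linarith⟩
  have ht := Real.lt_tan (x := x / 2) (by linarith) (by linarith)
  rw [Real.tan_eq_sin_div_cos, lt_div_iff₀ hc] at ht
  have e1 : Real.sin x = 2 * Real.sin (x / 2) * Real.cos (x / 2) := by
    rw [← Real.sin_two_mul]; ring_nf
  have e2 : Real.cos x = 2 * Real.cos (x / 2) ^ 2 - 1 := by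
    rw [← Real.cos_two_mul]; ring_nf
  rw [e1, e2, div_le_div_iff₀ (by positivity) hx]
  nlinarith

/-- The Kuzmin–Landau inequality, for increments between `δ` and `1 - δ`. -/
lemma kuzmin_landau_aux {x : ℕ → ℝ} {p q : ℕ} {δ : ℝ} (hδ : 0 < δ) (hpq : p ≤ q)
    (hmono : ∀ n, p ≤ n → n + 1 ≤ q → x (n + 1) - x n ≤ x (n + 2) - x (n + 1))
    (hlo : ∀ n, p ≤ n → n ≤ q → δ ≤ x (n + 1) - x n)
    (hhi : ∀ n, p ≤ n → n ≤ q → x (n + 1) - x n ≤ 1 - δ) :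
    ‖∑ n ∈ Finset.Icc p q, phase (x n)‖ ≤ 2 / (Real.pi * δ) := by
  have hp := Real.pi_pos
  have sinpos : ∀ n, p ≤ n → n ≤ q → 0 < Real.sin (Real.pi * (x (n + 1) - x n)) := by
    intro n h1 h2
    have := hlo n h1 h2
    have := hhi n h1 h2
    exact Real.sin_pos_of_pos_of_lt_pi (mul_pos hp (by linarith)) (by nlinarith)
  have step : ∀ n, p ≤ n → n ≤ q → phase (x n)
      = (phase (x n) - phase (x (n + 1))) * phaseCoeff (x (n + 1) - x n) := by
    intro n h1 h2
    have h3 := phaseCoeff_mul (sinpos n h1 h2).ne'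
    have h4 : phase (x (n + 1)) = phase (x n) * phase (x (n + 1) - x n) := by
      rw [← phase_add]; ring_nf
    rw [h4]
    linear_combination (-phase (x n)) * h3
  -- Summation by parts with its boundary term kept on the left. The right side is the initial
  -- coefficient plus the telescoped cotangent variation.
  have key : ∀ m, p ≤ m → m ≤ q → ‖∑ n ∈ Finset.Icc p m, phase (x n)
      + phase (x (m + 1)) * phaseCoeff (x (m + 1) - x m)‖
      ≤ ‖phaseCoeff (x (p + 1) - x p)‖
        + (Real.cos (Real.pi * (x (p + 1) - x p)) / Real.sin (Real.pi * (x (p + 1) - x p))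
          - Real.cos (Real.pi * (x (m + 1) - x m)) / Real.sin (Real.pi * (x (m + 1) - x m))) / 2 := by
    intro m hm
    induction m, hm using Nat.le_induction with
    | base =>
      intro h
      have h1 : phase (x p) + phase (x (p + 1)) * phaseCoeff (x (p + 1) - x p)
          = phase (x p) * phaseCoeff (x (p + 1) - x p) := by
        linear_combination step p le_rfl h
      simp [h1, norm_phase]
    | succ m hm ih =>
      intro h
      have h0 := ih (by omega)
      have h1 : ∑ n ∈ Finset.Icc p (m + 1), phase (x n)
          + phase (x (m + 1 + 1)) * phaseCoeff (x (m + 1 + 1) - x (m + 1))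
          = (∑ n ∈ Finset.Icc p m, phase (x n)
            + phase (x (m + 1)) * phaseCoeff (x (m + 1) - x m))
            + phase (x (m + 1)) * (phaseCoeff (x (m + 1 + 1) - x (m + 1))
              - phaseCoeff (x (m + 1) - x m)) := by
        rw [Finset.sum_Icc_succ_top (by omega)]
        linear_combination step (m + 1) (by omega) h
      have h2 := norm_phaseCoeff_sub (lt_of_lt_of_le hδ (hlo m hm (by omega))) (hmono m hm h)
        (by linarith [hhi (m + 1) (by omega) h])
      rw [h1]
      refine (norm_add_le _ _).trans ?_
      rw [norm_mul, norm_phase, one_mul, h2]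
      linarith
  have hq := key q hpq le_rfl
  have hs := sinpos p le_rfl hpq
  have hs' := sinpos q hpq le_rfl
  -- Each end of the sum contributes at most half of this quantity. The reflection `θ ↦ 1 - θ`
  -- reduces a negative cosine to the case of a positive one.
  have hθ : ∀ n, p ≤ n → n ≤ q → 1 / Real.sin (Real.pi * (x (n + 1) - x n))
      + |Real.cos (Real.pi * (x (n + 1) - x n))| / Real.sin (Real.pi * (x (n + 1) - x n))
      ≤ 2 / (Real.pi * δ) := by
    intro n h1 h2
    have hl := hlo n h1 h2
    have hh := hhi n h1 h2
    have : ∀ θ, δ ≤ θ → θ ≤ 1 - δ →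
        (1 + Real.cos (Real.pi * θ)) / Real.sin (Real.pi * θ) ≤ 2 / (Real.pi * δ) := by
      intro θ h1 h2
      refine (one_add_cos_div_sin_le (by nlinarith) (by nlinarith)).trans ?_
      gcongr
    rw [← add_div]
    rcases abs_cases (Real.cos (Real.pi * (x (n + 1) - x n))) with h | h
    · rw [h.1]
      exact this _ hl hh
    · rw [h.1]
      have := this (1 - (x (n + 1) - x n)) (by linarith) (by linarith)
      rwa [mul_sub, mul_one, Real.cos_pi_sub, Real.sin_pi_sub] at this
  have h1 := hθ p le_rfl hpq
  have h2 := hθ q hpq le_rfl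
  have e1 := norm_phaseCoeff hs
  have e2 := norm_phaseCoeff hs'
  have a1 : Real.cos (Real.pi * (x (p + 1) - x p)) / Real.sin (Real.pi * (x (p + 1) - x p)) ≤
      |Real.cos (Real.pi * (x (p + 1) - x p))| / Real.sin (Real.pi * (x (p + 1) - x p)) := by
    gcongr; exact le_abs_self _
  have a2 : -(Real.cos (Real.pi * (x (q + 1) - x q)) / Real.sin (Real.pi * (x (q + 1) - x q))) ≤
      |Real.cos (Real.pi * (x (q + 1) - x q))| / Real.sin (Real.pi * (x (q + 1) - x q)) := by
    rw [← neg_div]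
    gcongr; exact neg_le_abs _
  have tri : ‖∑ n ∈ Finset.Icc p q, phase (x n)‖
      ≤ ‖∑ n ∈ Finset.Icc p q, phase (x n)
        + phase (x (q + 1)) * phaseCoeff (x (q + 1) - x q)‖ + ‖phaseCoeff (x (q + 1) - x q)‖ := by
    have := norm_sub_le (∑ n ∈ Finset.Icc p q, phase (x n)
        + phase (x (q + 1)) * phaseCoeff (x (q + 1) - x q))
        (phase (x (q + 1)) * phaseCoeff (x (q + 1) - x q))
    rwa [add_sub_cancel_right, norm_mul, norm_phase, one_mul] at this
  rw [show ∀ s : ℝ, 1 / (2 * s) = 1 / s / 2 by intro s; rw [div_div, mul_comm]] at e1 e2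
  linarith

/-- The Kuzmin–Landau inequality. -/
lemma kuzmin_landau {x : ℕ → ℝ} {p q : ℕ} {δ : ℝ} (k : ℤ) (hδ : 0 < δ) (hpq : p ≤ q)
    (hmono : ∀ n, p ≤ n → n + 1 ≤ q → x (n + 1) - x n ≤ x (n + 2) - x (n + 1))
    (hlo : ∀ n, p ≤ n → n ≤ q → k + δ ≤ x (n + 1) - x n)
    (hhi : ∀ n, p ≤ n → n ≤ q → x (n + 1) - x n ≤ k + 1 - δ) :
    ‖∑ n ∈ Finset.Icc p q, phase (x n)‖ ≤ 2 / (Real.pi * δ) := by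
  -- Subtracting `k * n` leaves every phase unchanged and moves the increments from `[k + δ, k + 1 -
  -- δ]` into `[δ, 1 - δ]`.
  have := kuzmin_landau_aux (x := fun n => x n - k * n) hδ hpq
    (fun n h1 h2 => by have := hmono n h1 h2; push_cast; linarith)
    (fun n h1 h2 => by have := hlo n h1 h2; push_cast; linarith)
    (fun n h1 h2 => by have := hhi n h1 h2; push_cast; linarith)
  simpa only [phase_sub_int_mul] using this

/-! ### The second derivative test for sequences. -/

/-- Increments are monotone, so the indices whose increment lies in a given interval form a convex
set. This lemma turns such a set into a range of summation. -/
lemma Finset.exists_eq_Icc_of_convex {S : Finset ℕ} (hS : S.Nonempty)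
    (h : ∀ a ∈ S, ∀ b ∈ S, ∀ n, a ≤ n → n ≤ b → n ∈ S) :
    ∃ p q, p ≤ q ∧ S = Finset.Icc p q := by
  refine ⟨S.min' hS, S.max' hS, S.min'_le_max' hS, ?_⟩
  ext n
  rw [Finset.mem_Icc]
  exact ⟨fun hn => ⟨S.min'_le n hn, S.le_max' n hn⟩,
    fun hn => h _ (S.min'_mem hS) _ (S.max'_mem hS) n hn.1 hn.2⟩

/-- A discrete second derivative test with a free parameter `δ`. -/
lemma norm_sum_phase_le_of_param {x : ℕ → ℝ} {M N : ℕ} {lam α V δ : ℝ} (hlam : 0 < lam)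
    (hV : 0 ≤ V) (hδ : 0 < δ)
    (hinc : ∀ n, M ≤ n → n + 1 < N → x (n + 1) - x n + lam ≤ x (n + 2) - x (n + 1))
    (hlo : ∀ n, M ≤ n → n < N → α ≤ x (n + 1) - x n)
    (hhi : ∀ n, M ≤ n → n < N → x (n + 1) - x n ≤ α + V) :
    ‖∑ n ∈ Finset.Ico M N, phase (x n)‖
      ≤ (V + 2) * (2 * δ / lam + 1 + 2 / (Real.pi * δ)) := by
  have hp := Real.pi_pos
  have hgrow : ∀ p q, M ≤ p → p ≤ q → q < N →
      x (p + 1) - x p + (q - p : ℝ) * lam ≤ x (q + 1) - x q := by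
    intro p q hMp hpq
    induction q, hpq using Nat.le_induction with
    | base => intro; simp
    | succ q hq ih =>
      intro h
      have := ih (by omega)
      have := hinc q (by omega) h
      push_cast
      linarith
  have hmono : ∀ p q, M ≤ p → p ≤ q → q < N → x (p + 1) - x p ≤ x (q + 1) - x q := by
    intro p q h1 h2 h3
    have := hgrow p q h1 h2 h3
    have : (p : ℝ) ≤ q := by exact_mod_cast h2
    nlinarith
  -- The fibre over `k` consists of the increments in `[k - δ, k + 1 - δ)`. It splits at `k + δ`
  -- into a part near `k`, counted using the growth rate `lam`, and a part treated by Kuzmin–Landau.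
  have hmaps : ∀ n ∈ Finset.Ico M N, ⌊x (n + 1) - x n + δ⌋
      ∈ Finset.Icc ⌊α + δ⌋ ⌊α + V + δ⌋ := by
    intro n hn
    rw [Finset.mem_Ico] at hn
    rw [Finset.mem_Icc]
    have := hlo n hn.1 hn.2
    have := hhi n hn.1 hn.2
    exact ⟨Int.floor_le_floor (by linarith), Int.floor_le_floor (by linarith)⟩
  rw [← Finset.sum_fiberwise_of_maps_to hmaps]
  refine (norm_sum_le _ _).trans ?_
  have hfib : ∀ k ∈ Finset.Icc ⌊α + δ⌋ ⌊α + V + δ⌋,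
      ‖∑ n ∈ (Finset.Ico M N).filter (fun n => ⌊x (n + 1) - x n + δ⌋ = k), phase (x n)‖
        ≤ 2 * δ / lam + 1 + 2 / (Real.pi * δ) := by
    intro k _
    rw [← Finset.sum_filter_add_sum_filter_not _ (fun n => x (n + 1) - x n < k + δ)]
    refine (norm_add_le _ _).trans (add_le_add ?_ ?_)
    · refine (norm_sum_le _ _).trans ?_
      simp only [norm_phase, Finset.sum_const, nsmul_eq_mul, mul_one]
      rw [Finset.filter_filter]
      rcases Finset.eq_empty_or_nonempty ((Finset.Ico M N).filter
        (fun n => ⌊x (n + 1) - x n + δ⌋ = k ∧ x (n + 1) - x n < k + δ)) with h | h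
      · rw [h]; simp; positivity
      · obtain ⟨p, q, hpq, hS⟩ := Finset.exists_eq_Icc_of_convex h (by
          intro a ha b hb n han hnb
          simp only [Finset.mem_filter, Finset.mem_Ico, Int.floor_eq_iff] at ha hb ⊢
          have h1 := hmono a n ha.1.1 han (by omega)
          have h2 := hmono n b (by omega) hnb hb.1.2
          refine ⟨by omega, ⟨by linarith, by linarith⟩, by linarith⟩)
        have hmem : ∀ n ∈ Finset.Icc p q, _ := fun n hn => by
          rw [← hS] at hn
          exact (by simpa only [Finset.mem_filter, Finset.mem_Ico, Int.floor_eq_iff] using hn)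
        have hP := hmem p (Finset.left_mem_Icc.2 hpq)
        have hQ := hmem q (Finset.right_mem_Icc.2 hpq)
        have := hgrow p q hP.1.1 hpq hQ.1.2
        rw [hS, Nat.card_Icc, Nat.cast_sub (by omega)]
        have h3 : (q - p : ℝ) ≤ 2 * δ / lam := by
          rw [le_div_iff₀ hlam]
          linarith [hP.2.1.1, hQ.2.2]
        push_cast
        linarith
    · rw [Finset.filter_filter]
      rcases Finset.eq_empty_or_nonempty ((Finset.Ico M N).filter
        (fun n => ⌊x (n + 1) - x n + δ⌋ = k ∧ ¬ x (n + 1) - x n < k + δ)) with h | h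
      · rw [h]; simp; positivity
      · obtain ⟨p, q, hpq, hS⟩ := Finset.exists_eq_Icc_of_convex h (by
          intro a ha b hb n han hnb
          simp only [Finset.mem_filter, Finset.mem_Ico, Int.floor_eq_iff, not_lt] at ha hb ⊢
          have h1 := hmono a n ha.1.1 han (by omega)
          have h2 := hmono n b (by omega) hnb hb.1.2
          refine ⟨by omega, ⟨by linarith, by linarith⟩, by linarith⟩)
        have hmem : ∀ n ∈ Finset.Icc p q, _ := fun n hn => by
          rw [← hS] at hn
          exact (by simpa only [Finset.mem_filter, Finset.mem_Ico, Int.floor_eq_iff, not_lt] using hn)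
        rw [hS]
        refine kuzmin_landau k hδ hpq ?_ ?_ ?_
        · intro n h1 h2
          have hn := hmem n (Finset.mem_Icc.2 ⟨h1, by omega⟩)
          have hn' := hmem (n + 1) (Finset.mem_Icc.2 ⟨by omega, h2⟩)
          linarith [hinc n hn.1.1 hn'.1.2]
        · intro n h1 h2
          exact (hmem n (Finset.mem_Icc.2 ⟨h1, h2⟩)).2.2
        · intro n h1 h2
          linarith [(hmem n (Finset.mem_Icc.2 ⟨h1, h2⟩)).2.1.2]
  refine (Finset.sum_le_sum hfib).trans ?_
  rw [Finset.sum_const, nsmul_eq_mul]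
  apply mul_le_mul_of_nonneg_right _ (by positivity)
  rw [Int.card_Icc]
  have h1 : ⌊α + δ⌋ ≤ ⌊α + V + δ⌋ := Int.floor_le_floor (by linarith)
  have h2 : (((⌊α + V + δ⌋ + 1 - ⌊α + δ⌋).toNat : ℤ) : ℝ)
      = ((⌊α + V + δ⌋ + 1 - ⌊α + δ⌋ : ℤ) : ℝ) := by
    rw [Int.toNat_of_nonneg (by omega)]
  rw [Int.cast_natCast] at h2
  rw [h2]
  push_cast
  linarith [Int.floor_le (α + V + δ), Int.lt_floor_add_one (α + δ)]

/-- A discrete second derivative test. -/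
lemma norm_sum_phase_le {x : ℕ → ℝ} {M N : ℕ} {lam α V : ℝ} (hlam : 0 < lam) (hV : 0 ≤ V)
    (hinc : ∀ n, M ≤ n → n + 1 < N → x (n + 1) - x n + lam ≤ x (n + 2) - x (n + 1))
    (hlo : ∀ n, M ≤ n → n < N → α ≤ x (n + 1) - x n)
    (hhi : ∀ n, M ≤ n → n < N → x (n + 1) - x n ≤ α + V) :
    ‖∑ n ∈ Finset.Ico M N, phase (x n)‖ ≤ (V + 2) * (4 / √(Real.pi * lam) + 1) := by
  have hp := Real.pi_pos
  have hr : 0 < √(Real.pi * lam) := Real.sqrt_pos.2 (by positivity)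
  have hsq : √(Real.pi * lam) ^ 2 = Real.pi * lam := Real.sq_sqrt (by positivity)
  -- This is `δ = √(lam / π)`, which makes `2δ / lam` and `2 / (πδ)` equal.
  have := norm_sum_phase_le_of_param hlam hV (δ := √(Real.pi * lam) / Real.pi) (by positivity)
    hinc hlo hhi
  have e : 2 * (√(Real.pi * lam) / Real.pi) / lam + 1
      + 2 / (Real.pi * (√(Real.pi * lam) / Real.pi)) = 4 / √(Real.pi * lam) + 1 := by
    generalize √(Real.pi * lam) = r at *
    field_simp
    linear_combination 2 * hsq
  rwa [e] at this

/-! ### The Weyl–van der Corput inequality. -/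

/-- The sequence `z`, cut off to `[0, L)` and shifted by `h`. -/
noncomputable def shiftSeq (z : ℕ → ℂ) (L h m : ℕ) : ℂ :=
  if m ∈ Finset.Ico h (h + L) then z (m - h) else 0

lemma sum_shiftSeq (z : ℕ → ℂ) {L h H : ℕ} (hh : h ≤ H) :
    ∑ m ∈ Finset.range (L + H), shiftSeq z L h m = ∑ j ∈ Finset.range L, z j := by
  unfold shiftSeq
  rw [← Finset.sum_filter]
  have : (Finset.range (L + H)).filter (fun m => m ∈ Finset.Ico h (h + L))
      = Finset.Ico h (h + L) := by
    ext m
    simp only [Finset.mem_filter, Finset.mem_range, Finset.mem_Ico]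
    omega
  rw [this, Finset.sum_Ico_eq_sum_range]
  simp

/-- The two shifted supports overlap in `[h + k, h + L)`, so the correlation depends only on the
relative shift `k`. Truncated subtraction in `L - k` covers disjoint supports. -/
lemma sum_shiftSeq_mul_conj (z : ℕ → ℂ) {L h k H : ℕ} (hh : h + k ≤ H) :
    ∑ m ∈ Finset.range (L + H), shiftSeq z L (h + k) m * (starRingEnd ℂ) (shiftSeq z L h m)
      = ∑ j ∈ Finset.range (L - k), z j * (starRingEnd ℂ) (z (j + k)) := by
  have h1 : ∀ m, shiftSeq z L (h + k) m * (starRingEnd ℂ) (shiftSeq z L h m)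
      = if m ∈ Finset.Ico (h + k) (h + L) then
          z (m - (h + k)) * (starRingEnd ℂ) (z (m - h)) else 0 := by
    intro m
    unfold shiftSeq
    simp only [Finset.mem_Ico]
    split_ifs <;> first | rfl | (exfalso; omega) | simp
  simp only [h1]
  rw [← Finset.sum_filter]
  have : (Finset.range (L + H)).filter (fun m => m ∈ Finset.Ico (h + k) (h + L))
      = Finset.Ico (h + k) (h + L) := by
    ext m
    simp only [Finset.mem_filter, Finset.mem_range, Finset.mem_Ico]
    omega
  rw [this, Finset.sum_Ico_eq_sum_range]
  rw [show h + L - (h + k) = L - k by omega]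
  refine Finset.sum_congr rfl fun j _ => ?_
  congr 3 <;> omega

/-- For fixed `h`, distance 0 occurs once and every positive distance at most twice, once on each
side. Here `max - min` is the absolute difference in `ℕ`. -/
lemma sum_dist_le {D : ℕ → ℝ} (hD : ∀ k, 0 ≤ D k) {h H : ℕ} (hh : h < H) :
    ∑ h' ∈ Finset.range H, D (max h h' - min h h')
      ≤ D 0 + 2 * ∑ k ∈ Finset.range (H - 1), D (k + 1) := by
  have hsub : ∀ n, n ≤ H - 1 → ∑ k ∈ Finset.range n, D (k + 1)
      ≤ ∑ k ∈ Finset.range (H - 1), D (k + 1) := fun n hn =>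
    Finset.sum_le_sum_of_subset_of_nonneg (Finset.range_subset_range.2 hn) fun _ _ _ => hD _
  rw [← Finset.sum_range_add_sum_Ico _ hh.le, Finset.sum_eq_sum_Ico_succ_bot hh,
    Finset.sum_Ico_eq_sum_range, ← Finset.sum_range_reflect]
  have e1 : ∑ j ∈ Finset.range h, D (max h (h - 1 - j) - min h (h - 1 - j))
      = ∑ k ∈ Finset.range h, D (k + 1) := by
    refine Finset.sum_congr rfl fun j hj => ?_
    rw [Finset.mem_range] at hj
    congr 1
    omega
  have e2 : ∑ j ∈ Finset.range (H - (h + 1)), D (max h (h + 1 + j) - min h (h + 1 + j))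
      = ∑ k ∈ Finset.range (H - (h + 1)), D (k + 1) := by
    refine Finset.sum_congr rfl fun j hj => ?_
    congr 1
    omega
  rw [e1, e2]
  have := hsub h (by omega)
  have := hsub (H - (h + 1)) (by omega)
  simp only [max_self, min_self, Nat.sub_self]
  linarith

/-- The Weyl–van der Corput inequality. -/
lemma weyl_van_der_corput (z : ℕ → ℂ) (L H : ℕ) :
    (H : ℝ) ^ 2 * ‖∑ j ∈ Finset.range L, z j‖ ^ 2
      ≤ (L + H) * (H * (‖∑ j ∈ Finset.range L, z j * (starRingEnd ℂ) (z j)‖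
        + 2 * ∑ k ∈ Finset.range (H - 1),
            ‖∑ j ∈ Finset.range (L - (k + 1)), z j * (starRingEnd ℂ) (z (j + (k + 1)))‖)) := by
  set D : ℕ → ℝ := fun k => ‖∑ j ∈ Finset.range (L - k), z j * (starRingEnd ℂ) (z (j + k))‖ with hD
  set u := shiftSeq z L with hu
  have hC : ∀ a ∈ Finset.range H, ∀ b ∈ Finset.range H,
      ‖∑ m ∈ Finset.range (L + H), u a m * (starRingEnd ℂ) (u b m)‖
        = D (max a b - min a b) := by
    have key : ∀ a b, b ≤ a → a < H →
        ‖∑ m ∈ Finset.range (L + H), u a m * (starRingEnd ℂ) (u b m)‖ = D (a - b) := by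
      intro a b hab ha
      obtain ⟨k, rfl⟩ := Nat.exists_eq_add_of_le hab
      rw [hu, sum_shiftSeq_mul_conj z ha.le, Nat.add_sub_cancel_left]
    intro a ha b hb
    rw [Finset.mem_range] at ha hb
    rcases le_total b a with h | h
    · rw [key a b h ha, max_eq_left h, min_eq_right h]
    · rw [max_eq_right h, min_eq_left h, ← key b a h hb, ← Complex.norm_conj, map_sum]
      congr 1
      refine Finset.sum_congr rfl fun m _ => ?_
      rw [map_mul, Complex.conj_conj, mul_comm]
  -- Averaging over `H` shifts: all window sums together count each term `H` times. Cauchy–Schwarz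
  -- over the `L + H` windows then gives the inequality.
  have h1 : (H : ℂ) * ∑ j ∈ Finset.range L, z j
      = ∑ m ∈ Finset.range (L + H), ∑ h ∈ Finset.range H, u h m := by
    rw [Finset.sum_comm, Finset.sum_congr rfl fun h hh =>
      sum_shiftSeq z (L := L) (Finset.mem_range.1 hh).le]
    simp
  have h2 : (H : ℝ) ^ 2 * ‖∑ j ∈ Finset.range L, z j‖ ^ 2
      = ‖∑ m ∈ Finset.range (L + H), ∑ h ∈ Finset.range H, u h m‖ ^ 2 := by
    rw [← h1, norm_mul, mul_pow, Complex.norm_natCast]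
  have h3 : ∑ m ∈ Finset.range (L + H), ‖∑ h ∈ Finset.range H, u h m‖ ^ 2
      ≤ H * (D 0 + 2 * ∑ k ∈ Finset.range (H - 1), D (k + 1)) := by
    have e : ((∑ m ∈ Finset.range (L + H), ‖∑ h ∈ Finset.range H, u h m‖ ^ 2 : ℝ) : ℂ)
        = ∑ a ∈ Finset.range H, ∑ b ∈ Finset.range H,
          ∑ m ∈ Finset.range (L + H), u a m * (starRingEnd ℂ) (u b m) := by
      push_cast
      rw [Finset.sum_congr rfl fun a _ => Finset.sum_comm, Finset.sum_comm]
      refine Finset.sum_congr rfl fun m _ => ?_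
      rw [← Complex.mul_conj', map_sum, Finset.sum_mul_sum]
    have e' := congrArg norm e
    rw [Complex.norm_real, Real.norm_of_nonneg (Finset.sum_nonneg fun _ _ => by positivity)] at e'
    rw [e']
    refine (norm_sum_le _ _).trans ((Finset.sum_le_sum (g := fun _ =>
      D 0 + 2 * ∑ k ∈ Finset.range (H - 1), D (k + 1)) fun a ha => ?_).trans
      (by rw [Finset.sum_const, Finset.card_range, nsmul_eq_mul]))
    refine (norm_sum_le _ _).trans ?_
    rw [Finset.sum_congr rfl fun b hb => hC a ha b hb]
    exact sum_dist_le (D := D) (fun _ => norm_nonneg _) (Finset.mem_range.1 ha)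
  have h4 : ‖∑ m ∈ Finset.range (L + H), ∑ h ∈ Finset.range H, u h m‖ ^ 2
      ≤ (L + H) * ∑ m ∈ Finset.range (L + H), ‖∑ h ∈ Finset.range H, u h m‖ ^ 2 := by
    refine (pow_le_pow_left₀ (norm_nonneg _) (norm_sum_le _ _) 2).trans ?_
    refine sq_sum_le_card_mul_sum_sq.trans (le_of_eq ?_)
    simp
  rw [h2]
  refine h4.trans (mul_le_mul_of_nonneg_left ?_ (by positivity))
  simpa [hD] using h3

/-! ### Finite differences of the logarithm on a dyadic block. -/

/-- Taking `lam = r ^ 2 / 4` removes the square root: the constant is `8 / √π < 4.6`. The factor 1/4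
suits logarithmic phases, whose smallest second difference on a block occurs near `2y`. -/
lemma norm_sum_phase_le_of_sq {x : ℕ → ℝ} {M N : ℕ} {r α V : ℝ} (hr : 0 < r) (hV : 0 ≤ V)
    (hinc : ∀ n, M ≤ n → n + 1 < N → x (n + 1) - x n + r ^ 2 / 4 ≤ x (n + 2) - x (n + 1))
    (hlo : ∀ n, M ≤ n → n < N → α ≤ x (n + 1) - x n)
    (hhi : ∀ n, M ≤ n → n < N → x (n + 1) - x n ≤ α + V) :
    ‖∑ n ∈ Finset.Ico M N, phase (x n)‖ ≤ (V + 2) * (4.6 / r + 1) := by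
  refine (norm_sum_phase_le (by positivity) hV hinc hlo hhi).trans ?_
  have h : 0.88 * r ≤ √(Real.pi * (r ^ 2 / 4)) := by
    apply Real.le_sqrt_of_sq_le
    nlinarith [Real.pi_gt_d2, sq_nonneg r]
  have h2 : 4 / √(Real.pi * (r ^ 2 / 4)) ≤ 4.6 / r := by
    refine (div_le_div_of_nonneg_left (by norm_num) (by positivity) h).trans ?_
    rw [div_le_div_iff₀ (by positivity) hr]
    nlinarith
  gcongr

/-- For `v = (m + 1)² / (m (m + 2))`, the right side is `log v` and `1 - 1/v` is exactly `1 / (m +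
1)²`. So this is `log v ≥ 1 - 1/v`. -/
lemma inv_sq_le_second_diff_log {m : ℝ} (hm : 0 < m) :
    1 / (m + 1) ^ 2 ≤ 2 * Real.log (m + 1) - Real.log m - Real.log (m + 2) := by
  have h := Real.one_sub_inv_le_log_of_pos (x := (m + 1) ^ 2 / (m * (m + 2))) (by positivity)
  rw [Real.log_div (by positivity) (by positivity), Real.log_mul (by positivity) (by positivity),
    Real.log_pow] at h
  have e : 1 - ((m + 1) ^ 2 / (m * (m + 2)))⁻¹ = 1 / (m + 1) ^ 2 := by
    field_simp
    ring
  rw [e] at h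
  push_cast at h
  linarith

/-- A discrete form of `(log u)''' = 2 / u³`. Again `log v ≥ 1 - 1/v` is applied to the ratio inside
the combined logarithm, and the resulting fraction splits into two terms, each at least `h / Y³`. -/
lemma le_second_diff_log_sub {m h Y : ℝ} (hm : 0 < m) (hh : 0 ≤ h) (hY : m + 1 + h ≤ Y) :
    2 * h / Y ^ 3 ≤ (2 * Real.log (m + 1) - Real.log m - Real.log (m + 2))
      - (2 * Real.log (m + 1 + h) - Real.log (m + h) - Real.log (m + 2 + h)) := by
  have h1 := Real.one_sub_inv_le_log_of_pos
    (x := (m + 1) ^ 2 * ((m + h) * (m + 2 + h)) / (m * (m + 2) * (m + 1 + h) ^ 2)) (by positivity)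
  rw [Real.log_div (by positivity) (by positivity), Real.log_mul (by positivity) (by positivity),
    Real.log_mul (by positivity) (by positivity), Real.log_mul (by positivity) (by positivity),
    Real.log_mul (by positivity) (by positivity),
    Real.log_pow, Real.log_pow] at h1
  push_cast at h1
  refine le_trans ?_ (h1.trans (by linarith))
  have e : 1 - ((m + 1) ^ 2 * ((m + h) * (m + 2 + h)) / (m * (m + 2) * (m + 1 + h) ^ 2))⁻¹
      = h * (2 * (m + 1) + h) / ((m + 1) ^ 2 * ((m + h) * (m + 2 + h))) := by
    field_simp
    ring
  rw [e]
  have e2 : h * (2 * (m + 1) + h) / ((m + 1) ^ 2 * (m + 1 + h) ^ 2)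
      ≤ h * (2 * (m + 1) + h) / ((m + 1) ^ 2 * ((m + h) * (m + 2 + h))) := by
    gcongr
    nlinarith
  refine le_trans ?_ e2
  have e3 : h * (2 * (m + 1) + h) / ((m + 1) ^ 2 * (m + 1 + h) ^ 2)
      = h / ((m + 1) ^ 2 * (m + 1 + h)) + h / ((m + 1) * (m + 1 + h) ^ 2) := by
    field_simp
    ring
  rw [e3]
  have hmY : m + 1 ≤ Y := by linarith
  have hY0 : 0 ≤ Y := by linarith
  have b1 : h / Y ^ 3 ≤ h / ((m + 1) ^ 2 * (m + 1 + h)) := by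
    gcongr
    calc (m + 1) ^ 2 * (m + 1 + h) ≤ Y ^ 2 * Y := by gcongr
      _ = Y ^ 3 := by ring
  have b2 : h / Y ^ 3 ≤ h / ((m + 1) * (m + 1 + h) ^ 2) := by
    gcongr
    calc (m + 1) * (m + 1 + h) ^ 2 ≤ Y * Y ^ 2 := by gcongr
      _ = Y ^ 3 := by ring
  calc 2 * h / Y ^ 3 = h / Y ^ 3 + h / Y ^ 3 := by ring
    _ ≤ _ := add_le_add b1 b2

lemma diff_log_sub_nonneg {m h : ℝ} (hm : 0 < m) (hh : 0 ≤ h) :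
    0 ≤ Real.log (m + 1) - Real.log m - (Real.log (m + 1 + h) - Real.log (m + h)) := by
  have h1 : m * (m + 1 + h) ≤ (m + 1) * (m + h) := by nlinarith
  have h2 := Real.log_le_log (by positivity) h1
  rw [Real.log_mul (by positivity) (by positivity), Real.log_mul (by positivity) (by positivity)]
    at h2
  linarith

lemma diff_log_sub_le {m h y : ℝ} (hy : 0 < y) (hm : y ≤ m) (hh : 0 ≤ h) :
    Real.log (m + 1) - Real.log m - (Real.log (m + 1 + h) - Real.log (m + h)) ≤ h / y ^ 2 := by
  have hm0 : 0 < m := by linarith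
  have h1 := Real.log_le_sub_one_of_pos
    (x := (m + 1) * (m + h) / (m * (m + 1 + h))) (by positivity)
  rw [Real.log_div (by positivity) (by positivity), Real.log_mul (by positivity) (by positivity),
    Real.log_mul (by positivity) (by positivity)] at h1
  have e : (m + 1) * (m + h) / (m * (m + 1 + h)) - 1 = h / (m * (m + 1 + h)) := by
    field_simp
    ring
  rw [e] at h1
  have e2 : h / (m * (m + 1 + h)) ≤ h / y ^ 2 := by
    gcongr
    nlinarith
  linarith

/-- The second derivative test for `∑ n ^ (-it)` over a dyadic block. -/
lemma norm_sum_phase_log_le {T y : ℝ} (hT : 0 < T) (hy : 0 < y) {M N : ℕ} (hM : y < M)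
    (hN : (N : ℝ) ≤ 2 * y + 1) :
    ‖∑ n ∈ Finset.Ico M N, phase (-(T * Real.log n))‖
      ≤ (T / y + 2) * (4.6 * y / √T + 1) := by
  have hs : 0 < √T := Real.sqrt_pos.2 hT
  have hsq : √T ^ 2 = T := Real.sq_sqrt hT.le
  have hpos : ∀ n : ℕ, M ≤ n → y < (n : ℝ) := fun n hn =>
    hM.trans_le (by exact_mod_cast hn)
  have := norm_sum_phase_le_of_sq (x := fun n => -(T * Real.log n)) (M := M) (N := N)
    (r := √T / y) (α := -(T / y)) (V := T / y) (by positivity) (by positivity) ?_ ?_ ?_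
  · rwa [div_div_eq_mul_div] at this
  · intro n hn hn'
    have h0 := hpos n hn
    have h1 := inv_sq_le_second_diff_log (hy.trans h0)
    have h2 : (n : ℝ) + 1 ≤ 2 * y := by
      have : ((n + 1 + 1 : ℕ) : ℝ) ≤ N := by exact_mod_cast hn'
      push_cast at this
      linarith
    have h3 : (√T / y) ^ 2 / 4 = T * (1 / (2 * y) ^ 2) := by
      rw [div_pow, hsq]; field_simp; norm_num
    have h4 : T * (1 / (2 * y) ^ 2) ≤ T * (1 / ((n : ℝ) + 1) ^ 2) := by gcongr
    have h5 := mul_le_mul_of_nonneg_left h1 hT.le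
    rw [h3]
    push_cast
    linarith
  · intro n hn hn'
    have h0 := hpos n hn
    have h1 := Real.log_le_sub_one_of_pos (x := ((n : ℝ) + 1) / n)
      (div_pos (by linarith) (by linarith))
    rw [Real.log_div (by linarith) (by linarith)] at h1
    have h2 : ((n : ℝ) + 1) / n - 1 = 1 / n := by
      have : (n : ℝ) ≠ 0 := by linarith
      field_simp
      ring
    have h3 : 1 / (n : ℝ) ≤ 1 / y := by gcongr
    have h5 : T * (Real.log (n + 1) - Real.log n) ≤ T * (1 / y) := by
      apply mul_le_mul_of_nonneg_left _ hT.le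
      linarith
    rw [mul_one_div] at h5
    push_cast
    linarith
  · intro n hn hn'
    have h0 := hpos n hn
    have := Real.log_le_log (x := (n : ℝ)) (by linarith) (show (n : ℝ) ≤ n + 1 by linarith)
    push_cast
    nlinarith

/-- The second derivative test for the differenced sums, with `τ = a ^ 6` and `y = w ^ 2`. -/
lemma norm_sum_phase_log_diff_le {a w : ℝ} (ha : 0 < a) (hw : 0 < w) {M N h : ℕ} (hh : 0 < h)
    (hM : w ^ 2 < M) (hN : (N + h : ℝ) ≤ 2 * w ^ 2 + 1) :
    ‖∑ n ∈ Finset.Ico M N, phase (a ^ 6 * (Real.log ((n : ℝ) + h) - Real.log n))‖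
      ≤ (a ^ 6 * h / w ^ 4 + 2) * (4.6 * w ^ 3 / (a ^ 3 * √h) + 1) := by
  have hh' : (0 : ℝ) < h := by exact_mod_cast hh
  have hs : 0 < √(h : ℝ) := Real.sqrt_pos.2 hh'
  have hsq : √(h : ℝ) ^ 2 = h := Real.sq_sqrt hh'.le
  have hw2 : 0 < w ^ 2 := by positivity
  have hpos : ∀ n : ℕ, M ≤ n → w ^ 2 < (n : ℝ) := fun n hn =>
    hM.trans_le (by exact_mod_cast hn)
  -- The value of `r` makes `r² / 4 = a ^ 6 * (2h / (2w²)³)`, the lower bound for the second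
  -- difference. The first differences lie in `[-V, 0]`.
  have := norm_sum_phase_le_of_sq (x := fun n => a ^ 6 * (Real.log ((n : ℝ) + h) - Real.log n))
    (M := M) (N := N) (r := a ^ 3 * √h / w ^ 3) (α := -(a ^ 6 * h / w ^ 4))
    (V := a ^ 6 * h / w ^ 4) (by positivity) (by positivity) ?_ ?_ ?_
  · rwa [div_div_eq_mul_div] at this
  · intro n hn hn'
    have h0 := hpos n hn
    have h2 : (n : ℝ) + 1 + h ≤ 2 * w ^ 2 := by
      have : ((n + 1 + 1 : ℕ) : ℝ) ≤ N := by exact_mod_cast hn'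
      push_cast at this
      linarith
    have h1 := le_second_diff_log_sub (hw2.trans h0) hh'.le h2
    have h3 : (a ^ 3 * √h / w ^ 3) ^ 2 / 4 = a ^ 6 * (2 * h / (2 * w ^ 2) ^ 3) := by
      rw [div_pow, mul_pow, hsq]; field_simp; norm_num
    have h5 := mul_le_mul_of_nonneg_left h1 (show 0 ≤ a ^ 6 by positivity)
    rw [h3]
    push_cast
    linarith
  · intro n hn hn'
    have h0 := hpos n hn
    have h1 := diff_log_sub_le hw2 h0.le hh'.le
    have h5 := mul_le_mul_of_nonneg_left h1 (show 0 ≤ a ^ 6 by positivity)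
    have e : a ^ 6 * (h / (w ^ 2) ^ 2) = a ^ 6 * h / w ^ 4 := by ring
    rw [e] at h5
    push_cast
    linarith
  · intro n hn hn'
    have h0 := hpos n hn
    have h1 := diff_log_sub_nonneg (hw2.trans h0) hh'.le
    have h5 := mul_nonneg (show 0 ≤ a ^ 6 by positivity) h1
    push_cast
    linarith

/-! ### The third derivative test on a dyadic block. -/

lemma sum_inv_sqrt_le (n : ℕ) :
    ∑ k ∈ Finset.range n, 1 / √((k : ℝ) + 1) ≤ 2 * √(n : ℝ) := by
  induction n with
  | zero => simp
  | succ n ih =>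
    rw [Finset.sum_range_succ]
    have h1 : 0 < √((n : ℝ) + 1) := Real.sqrt_pos.2 (by positivity)
    have h2 : √((n : ℝ) + 1) ^ 2 = n + 1 := Real.sq_sqrt (by positivity)
    have h3 : √(n : ℝ) ^ 2 = n := Real.sq_sqrt (by positivity)
    have h4 : 1 / √((n : ℝ) + 1) ≤ 2 * (√((n : ℝ) + 1) - √(n : ℝ)) := by
      rw [div_le_iff₀ h1]
      nlinarith [sq_nonneg (√((n : ℝ) + 1) - √(n : ℝ))]
    push_cast
    linarith

lemma norm_sum_phase_le_length {x : ℕ → ℝ} {y : ℝ} (hy : 0 ≤ y) {M N : ℕ} (hM : y < M)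
    (hN : (N : ℝ) ≤ 2 * y + 1) : ‖∑ n ∈ Finset.Ico M N, phase (x n)‖ ≤ y + 1 ∧
      ((N - M : ℕ) : ℝ) ≤ y + 1 := by
  have h : ((N - M : ℕ) : ℝ) ≤ y + 1 := by
    rcases le_total M N with h | h
    · rw [Nat.cast_sub h]
      linarith
    · rw [Nat.sub_eq_zero_of_le h]
      push_cast
      linarith
  refine ⟨(norm_sum_le _ _).trans ?_, h⟩
  simpa [norm_phase] using h

lemma weyl_correlation_le {a w : ℝ} (ha : 0 < a) (hw : 0 < w) {M L H : ℕ}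
    (hM : w ^ 2 < M) (hL : ((M + L : ℕ) : ℝ) ≤ 2 * w ^ 2 + 1) (hH : (H : ℝ) ≤ w ^ 2 / a ^ 2) :
    ∑ k ∈ Finset.range (H - 1), ‖∑ j ∈ Finset.range (L - (k + 1)),
        phase (-(a ^ 6 * Real.log ((M + j : ℕ) : ℝ)))
          * (starRingEnd ℂ) (phase (-(a ^ 6 * Real.log ((M + (j + (k + 1)) : ℕ) : ℝ))))‖
      ≤ 4.6 * w ^ 2 + 18.4 * (w ^ 4 / a ^ 4) + a ^ 2 + 2 * (w ^ 2 / a ^ 2) := by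
  have hsH : √(H : ℝ) ≤ w / a := by
    rw [Real.sqrt_le_left (by positivity), div_pow]
    exact hH
  have hb : ∀ k ∈ Finset.range (H - 1), ‖∑ j ∈ Finset.range (L - (k + 1)),
        phase (-(a ^ 6 * Real.log ((M + j : ℕ) : ℝ)))
          * (starRingEnd ℂ) (phase (-(a ^ 6 * Real.log ((M + (j + (k + 1)) : ℕ) : ℝ))))‖
      ≤ (4.6 * a ^ 3 / w * (w / a) + a ^ 6 / w ^ 4 * (w ^ 2 / a ^ 2) + 2)
        + 9.2 * w ^ 3 / a ^ 3 * (1 / √((k : ℝ) + 1)) := by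
    intro k hk
    rw [Finset.mem_range] at hk
    have hk1 : ((k : ℝ) + 1) ≤ H := by exact_mod_cast (by omega : k + 1 ≤ H)
    have hs1 : √((k : ℝ) + 1) ≤ w / a := (Real.sqrt_le_sqrt hk1).trans hsH
    have hs0 : 0 < √((k : ℝ) + 1) := Real.sqrt_pos.2 (by positivity)
    have hsq : √((k : ℝ) + 1) ^ 2 = k + 1 := Real.sq_sqrt (by positivity)
    -- Multiplying by the conjugate differences the phase, leaving `a ^ 6 (log(n + k + 1) - log n)`.
    have e : ∑ j ∈ Finset.range (L - (k + 1)),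
        phase (-(a ^ 6 * Real.log ((M + j : ℕ) : ℝ)))
          * (starRingEnd ℂ) (phase (-(a ^ 6 * Real.log ((M + (j + (k + 1)) : ℕ) : ℝ))))
        = ∑ n ∈ Finset.Ico M (M + (L - (k + 1))),
          phase (a ^ 6 * (Real.log ((n : ℝ) + ((k + 1 : ℕ) : ℝ)) - Real.log n)) := by
      rw [Finset.sum_Ico_eq_sum_range, Nat.add_sub_cancel_left]
      refine Finset.sum_congr rfl fun j _ => ?_
      rw [← phase_neg, ← phase_add]
      congr 1
      push_cast
      ring_nf
    rw [e]
    rcases le_total L (k + 1) with h | h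
    · rw [Nat.sub_eq_zero_of_le h]
      simp only [add_zero, Finset.Ico_self, Finset.sum_empty, norm_zero]
      positivity
    · refine (norm_sum_phase_log_diff_le ha hw (Nat.succ_pos k) hM ?_).trans ?_
      · refine le_trans (le_of_eq ?_) hL
        rw [← Nat.cast_add]
        congr 1
        omega
      · push_cast
        have e2 : (a ^ 6 * ((k : ℝ) + 1) / w ^ 4 + 2) * (4.6 * w ^ 3 / (a ^ 3 * √((k : ℝ) + 1)) + 1)
            = 4.6 * a ^ 3 / w * √((k : ℝ) + 1) + a ^ 6 / w ^ 4 * (k + 1) + 2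
              + 9.2 * w ^ 3 / a ^ 3 * (1 / √((k : ℝ) + 1)) := by
          generalize √((k : ℝ) + 1) = s at *
          rw [← hsq]
          field_simp
          ring
        rw [e2]
        have := hk1.trans hH
        gcongr
  refine (Finset.sum_le_sum hb).trans ?_
  rw [Finset.sum_add_distrib, ← Finset.mul_sum, Finset.sum_const, Finset.card_range, nsmul_eq_mul]
  have h1 : ((H - 1 : ℕ) : ℝ) ≤ H := by exact_mod_cast Nat.sub_le H 1
  have h2 := (sum_inv_sqrt_le (H - 1)).trans
    (mul_le_mul_of_nonneg_left ((Real.sqrt_le_sqrt h1).trans hsH) zero_le_two)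
  calc _ ≤ w ^ 2 / a ^ 2 * (4.6 * a ^ 3 / w * (w / a) + a ^ 6 / w ^ 4 * (w ^ 2 / a ^ 2) + 2)
        + 9.2 * w ^ 3 / a ^ 3 * (2 * (w / a)) := by
        gcongr
        exact h1.trans hH
    _ = _ := by
        field_simp
        ring

/-- The third derivative test for `∑ n ^ (-it)` over a dyadic block, with `τ = a ^ 6`, `y = w ^ 2`. -/
lemma norm_sum_phase_log_le_third {a w : ℝ} (ha : 1.6 ≤ a) (hw : 1 ≤ w) (hwa : w ≤ a ^ 2)
    {M N : ℕ} (hM : w ^ 2 < M) (hN : (N : ℝ) ≤ 2 * w ^ 2 + 1) :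
    ‖∑ n ∈ Finset.Ico M N, phase (-(a ^ 6 * Real.log n))‖ ≤ 11.4 * a * w := by
  obtain ⟨htriv, hlen⟩ := norm_sum_phase_le_length (x := fun n => -(a ^ 6 * Real.log n))
    (sq_nonneg w) hM hN
  -- When the trivial bound fails, `w` exceeds `11.3 * a`, so the shift length `H` below is large
  -- and rounding it down costs less than 1%.
  by_cases hc : w ^ 2 + 1 ≤ 11.4 * a * w
  · exact htriv.trans hc
  push Not at hc
  have ha0 : 0 < a := by linarith
  have hw18 : 18 ≤ w := by
    by_contra h
    nlinarith
  have hwa2 : 11.3 * a ≤ w := by nlinarith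
  set L := N - M with hL
  rcases le_total N M with hNM | hNM
  · rw [Finset.Ico_eq_empty_of_le hNM]
    simp only [Finset.sum_empty, norm_zero]
    positivity
  have hML : M + L = N := by omega
  -- This is `H ≈ y τ ^ (-1/3)`, for which the diagonal term and the sum of the correlations are
  -- both of order `y = w ^ 2`.
  set H := ⌊w ^ 2 / a ^ 2⌋₊ with hHdef
  have hH : (H : ℝ) ≤ w ^ 2 / a ^ 2 := Nat.floor_le (by positivity)
  have hH' : w ^ 2 / a ^ 2 - 1 < H := Nat.sub_one_lt_floor _
  have hcorr := weyl_correlation_le ha0 (by linarith) hM (L := L) (by rw [hML]; exact hN) hH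
  have hweyl := weyl_van_der_corput (fun j => phase (-(a ^ 6 * Real.log ((M + j : ℕ) : ℝ)))) L H
  have hS : ∑ n ∈ Finset.Ico M N, phase (-(a ^ 6 * Real.log n))
      = ∑ j ∈ Finset.range L, phase (-(a ^ 6 * Real.log ((M + j : ℕ) : ℝ))) := by
    rw [Finset.sum_Ico_eq_sum_range]
  have hdiag : ‖∑ j ∈ Finset.range L, phase (-(a ^ 6 * Real.log ((M + j : ℕ) : ℝ)))
      * (starRingEnd ℂ) (phase (-(a ^ 6 * Real.log ((M + j : ℕ) : ℝ))))‖ ≤ L := by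
    refine (norm_sum_le _ _).trans ?_
    simp [norm_phase]
  rw [← hS] at hweyl
  set S := ‖∑ n ∈ Finset.Ico M N, phase (-(a ^ 6 * Real.log n))‖
  have hq1 : 127 ≤ w ^ 2 / a ^ 2 := by
    rw [le_div_iff₀ (by positivity)]
    nlinarith
  have hHlow : 0.99 * (w ^ 2 / a ^ 2) ≤ H := by linarith
  have hHpos : (0 : ℝ) < H := by linarith
  have ha2 : 2.56 ≤ a ^ 2 := by nlinarith
  have hq2 : w ^ 2 / a ^ 2 ≤ 0.3907 * w ^ 2 := by
    rw [div_le_iff₀ (by positivity)]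
    nlinarith [sq_nonneg w]
  -- The place where `y ≤ τ ^ (2/3)`, that is `w ≤ a ^ 2`, is needed.
  have hq3 : w ^ 4 / a ^ 4 ≤ w ^ 2 := by
    rw [div_le_iff₀ (by positivity), show w ^ 4 = w ^ 2 * w ^ 2 by ring]
    gcongr
    rw [show a ^ 4 = (a ^ 2) ^ 2 by ring]
    gcongr
  have hq4 : 127 * a ^ 2 ≤ w ^ 2 := by nlinarith
  have hw2 : 324 ≤ w ^ 2 := by nlinarith
  have hinner : ‖∑ j ∈ Finset.range L, phase (-(a ^ 6 * Real.log ((M + j : ℕ) : ℝ)))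
      * (starRingEnd ℂ) (phase (-(a ^ 6 * Real.log ((M + j : ℕ) : ℝ))))‖
      + 2 * ∑ k ∈ Finset.range (H - 1), ‖∑ j ∈ Finset.range (L - (k + 1)),
        phase (-(a ^ 6 * Real.log ((M + j : ℕ) : ℝ)))
          * (starRingEnd ℂ) (phase (-(a ^ 6 * Real.log ((M + (j + (k + 1)) : ℕ) : ℝ))))‖
      ≤ 49 * w ^ 2 := by linarith
  have hLH : (L + H : ℝ) ≤ 1.41 * w ^ 2 := by linarith
  have h1 : (H : ℝ) ^ 2 * S ^ 2 ≤ (1.41 * w ^ 2) * (H * (49 * w ^ 2)) :=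
    hweyl.trans (by gcongr)
  have h2 : (H : ℝ) * S ^ 2 ≤ 69.09 * w ^ 2 * w ^ 2 := by
    have : (H : ℝ) * (H * S ^ 2) ≤ H * (69.09 * w ^ 2 * w ^ 2) := by linarith
    exact le_of_mul_le_mul_left this hHpos
  have h3 : 0.99 * (w ^ 2 / a ^ 2) * S ^ 2 ≤ 69.09 * w ^ 2 * w ^ 2 :=
    (mul_le_mul_of_nonneg_right hHlow (sq_nonneg S)).trans h2
  have h4 : S ^ 2 ≤ (11.4 * a * w) ^ 2 := by
    have e : 0.99 * (w ^ 2 / a ^ 2) * S ^ 2 = w ^ 2 * (0.99 * S ^ 2 / a ^ 2) := by ring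
    have e2 : 0.99 * S ^ 2 / a ^ 2 ≤ 69.09 * w ^ 2 := by
      have : w ^ 2 * (0.99 * S ^ 2 / a ^ 2) ≤ w ^ 2 * (69.09 * w ^ 2) := by linarith
      exact le_of_mul_le_mul_left this (by positivity)
    rw [div_le_iff₀ (by positivity)] at e2
    have : 0 ≤ w ^ 2 * a ^ 2 := by positivity
    nlinarith
  exact (sq_le_sq₀ (norm_nonneg _) (by positivity)).1 h4

/-! ### Approximation of `ζ` by long partial sums. -/

/-- One step of Euler summation: the error is `s ∫ (u - m) u ^ (-s - 1) du` over `[m, m + 1]` up to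
sign, and `0 ≤ u - m ≤ 1`. Instead of integrating, the proof compares the derivative of an
antiderivative `F` vanishing at `m` with that of a real majorant `B`. -/
lemma norm_term_sub_le {s : ℂ} (hs : 0 < s.re) (hs1 : s ≠ 1) {m : ℕ} (hm : 0 < m) :
    ‖1 / ((m + 1 : ℕ) : ℂ) ^ s
        - ((m : ℂ) ^ (1 - s) / (s - 1) - ((m + 1 : ℕ) : ℂ) ^ (1 - s) / (s - 1))‖
      ≤ ‖s‖ / s.re * ((m : ℝ) ^ (-s.re) - ((m + 1 : ℕ) : ℝ) ^ (-s.re)) := by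
  have hm' : (0 : ℝ) < m := by exact_mod_cast hm
  have hs1' : s - 1 ≠ 0 := sub_ne_zero.2 hs1
  have hs1'' : 1 - s ≠ 0 := sub_ne_zero.2 hs1.symm
  have hs0 : s ≠ 0 := by rintro rfl; simp at hs
  set F : ℝ → ℂ := fun u => (m : ℂ) ^ (1 - s) / (s - 1) - (u : ℂ) ^ (1 - s) / (s - 1)
    - ((u - m : ℝ) : ℂ) * (u : ℂ) ^ (-s) with hF
  set F' : ℝ → ℂ := fun u => ((u - m : ℝ) : ℂ) * (s * (u : ℂ) ^ (-s - 1)) with hF'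
  have hder : ∀ u : ℝ, 0 < u → HasDerivAt F (F' u) u := by
    intro u hu
    have hu0 : (u : ℂ) ≠ 0 := by exact_mod_cast hu.ne'
    have h1 := hasDerivAt_ofReal_cpow_const (x := u) hu.ne' hs1''
    have h2 := hasDerivAt_ofReal_cpow_const (x := u) hu.ne' (neg_ne_zero.2 hs0)
    have h3 : HasDerivAt (fun u : ℝ => ((u - m : ℝ) : ℂ)) 1 u :=
      ((hasDerivAt_id u).sub_const (m : ℝ)).ofReal_comp
    refine (((h1.div_const (s - 1)).const_sub ((m : ℂ) ^ (1 - s) / (s - 1))).sub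
      (h3.mul h2)).congr_deriv ?_
    rw [hF', show 1 - s - 1 = -s by ring]
    field_simp
    ring
  set B : ℝ → ℝ := fun u => ‖s‖ / s.re * ((m : ℝ) ^ (-s.re) - u ^ (-s.re)) with hB
  set B' : ℝ → ℝ := fun u => ‖s‖ * u ^ (-s.re - 1) with hB'
  have hBder : ∀ u : ℝ, 0 < u → HasDerivAt B (B' u) u := by
    intro u hu
    have h1 := Real.hasDerivAt_rpow_const (x := u) (p := -s.re) (Or.inl hu.ne')
    refine ((h1.const_sub ((m : ℝ) ^ (-s.re))).const_mul (‖s‖ / s.re)).congr_deriv ?_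
    rw [hB']
    field_simp
  have hpos : ∀ u ∈ Set.Icc (m : ℝ) (m + 1), 0 < u := fun u hu => hm'.trans_le hu.1
  have key := image_norm_le_of_norm_deriv_right_le_deriv_boundary' (f := F) (f' := F') (B := B)
    (B' := B') (a := (m : ℝ)) (b := m + 1)
    (fun u hu => (hder u (hpos u hu)).continuousAt.continuousWithinAt)
    (fun u hu => (hder u (hpos u ⟨hu.1, hu.2.le⟩)).hasDerivWithinAt)
    (by simp [hF, hB])
    (fun u hu => (hBder u (hpos u hu)).continuousAt.continuousWithinAt)
    (fun u hu => (hBder u (hpos u ⟨hu.1, hu.2.le⟩)).hasDerivWithinAt)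
    (by
      intro u hu
      have hu0 := hpos u ⟨hu.1, hu.2.le⟩
      rw [hF', hB']
      simp only
      rw [norm_mul, norm_mul, Complex.norm_cpow_eq_rpow_re_of_pos hu0, Complex.norm_real,
        Real.norm_of_nonneg (by linarith [hu.1])]
      simp only [Complex.sub_re, Complex.neg_re, Complex.one_re]
      have : 0 ≤ ‖s‖ * u ^ (-s.re - 1) := by positivity
      nlinarith [hu.2])
    (Set.right_mem_Icc.2 (by linarith))
  rw [← norm_neg]
  refine le_trans (le_of_eq ?_) (key.trans (le_of_eq ?_))
  · congr 1
    rw [hF]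
    push_cast
    rw [Complex.cpow_neg]
    ring
  · rw [hB]
    push_cast
    rfl

lemma norm_sum_one_div_cpow_sub_le {s : ℂ} (hs : 0 < s.re) (hs1 : s ≠ 1) {M K : ℕ} (hM : 0 < M)
    (hMK : M ≤ K) :
    ‖∑ n ∈ Finset.Icc 1 K, 1 / (n : ℂ) ^ s - ∑ n ∈ Finset.Icc 1 M, 1 / (n : ℂ) ^ s
        - ((M : ℂ) ^ (1 - s) / (s - 1) - (K : ℂ) ^ (1 - s) / (s - 1))‖
      ≤ ‖s‖ / s.re * ((M : ℝ) ^ (-s.re) - (K : ℝ) ^ (-s.re)) := by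
  induction K, hMK using Nat.le_induction with
  | base => simp
  | succ K hK ih =>
    have h := norm_term_sub_le hs hs1 (hM.trans_le hK)
    have h2 := norm_add_le_of_le ih h
    rw [Finset.sum_Icc_succ_top (by omega)]
    refine le_trans (le_of_eq ?_) (h2.trans (le_of_eq ?_))
    · congr 1
      ring
    · ring

lemma norm_riemannZeta_sub_sum_le_of_one_lt {s : ℂ} (hs : 1 < s.re) {M : ℕ} (hM : 0 < M) :
    ‖riemannZeta s - ∑ n ∈ Finset.Icc 1 M, 1 / (n : ℂ) ^ s‖
      ≤ (M : ℝ) ^ (1 - s.re) / ‖s - 1‖ + ‖s‖ / s.re * (M : ℝ) ^ (-s.re) := by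
  have hs1 : s ≠ 1 := by rintro rfl; simp at hs
  have hs0 : s ≠ 0 := by rintro rfl; simp at hs; linarith
  have hM' : (0 : ℝ) < M := by exact_mod_cast hM
  have hsum := (Complex.summable_one_div_nat_cpow.2 hs).hasSum.tendsto_sum_nat
  rw [← zeta_eq_tsum_one_div_nat_cpow hs] at hsum
  have hsum2 : Filter.Tendsto (fun K : ℕ => ∑ n ∈ Finset.Icc 1 K, 1 / (n : ℂ) ^ s)
      Filter.atTop (nhds (riemannZeta s)) := by
    refine ((Filter.tendsto_add_atTop_iff_nat 1).2 hsum).congr fun K => ?_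
    rw [Finset.range_eq_Ico, Finset.sum_eq_sum_Ico_succ_bot (by omega)]
    simp only [Nat.cast_zero, Complex.zero_cpow hs0, div_zero, zero_add]
    rfl
  have hlim := (((hsum2.sub_const (∑ n ∈ Finset.Icc 1 M, 1 / (n : ℂ) ^ s))).norm)
  have hz : Filter.Tendsto (fun K : ℕ => (K : ℝ) ^ (1 - s.re)) Filter.atTop (nhds 0) := by
    have := (tendsto_rpow_neg_atTop (y := s.re - 1) (by linarith)).comp
      tendsto_natCast_atTop_atTop
    refine this.congr fun K => ?_
    simp
  have hr : Filter.Tendsto (fun K : ℕ => (M : ℝ) ^ (1 - s.re) / ‖s - 1‖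
      + (K : ℝ) ^ (1 - s.re) / ‖s - 1‖ + ‖s‖ / s.re * (M : ℝ) ^ (-s.re)) Filter.atTop
      (nhds ((M : ℝ) ^ (1 - s.re) / ‖s - 1‖ + 0 / ‖s - 1‖ + ‖s‖ / s.re * (M : ℝ) ^ (-s.re))) :=
    ((hz.div_const _).const_add _).add_const _
  rw [zero_div, add_zero] at hr
  refine le_of_tendsto_of_tendsto hlim hr ?_
  filter_upwards [Filter.eventually_ge_atTop M] with K hK
  have hK' : (0 : ℝ) < K := hM'.trans_le (by exact_mod_cast hK)
  have h1 := norm_sum_one_div_cpow_sub_le (by linarith) hs1 hM hK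
  have nrm : ∀ n : ℕ, (0 : ℝ) < n → ‖(n : ℂ) ^ (1 - s) / (s - 1)‖
      = (n : ℝ) ^ (1 - s.re) / ‖s - 1‖ := by
    intro n hn
    rw [norm_div, ← Complex.ofReal_natCast, Complex.norm_cpow_eq_rpow_re_of_pos hn]
    simp
  have h2 := norm_sub_le ((M : ℂ) ^ (1 - s) / (s - 1)) ((K : ℂ) ^ (1 - s) / (s - 1))
  rw [nrm M hM', nrm K hK'] at h2
  have h3 := norm_add_le_of_le h1 h2
  rw [sub_add_cancel] at h3
  have h4 : 0 ≤ ‖s‖ / s.re * (K : ℝ) ^ (-s.re) :=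
    mul_nonneg (div_nonneg (norm_nonneg _) (by linarith)) (by positivity)
  linarith

/-- On the line `σ = 1` the Dirichlet series is not available. Since `t ≠ 0`, both sides are
continuous there and the bound passes to the limit from the right. -/
lemma norm_riemannZeta_sub_sum_le {σ t : ℝ} (hσ : 1 ≤ σ) (ht : t ≠ 0) {M : ℕ} (hM : 0 < M) :
    ‖riemannZeta (σ + t * Complex.I) - ∑ n ∈ Finset.Icc 1 M, 1 / (n : ℂ) ^ (σ + t * Complex.I)‖
      ≤ (M : ℝ) ^ (1 - σ) / ‖(σ + t * Complex.I : ℂ) - 1‖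
        + ‖(σ + t * Complex.I : ℂ)‖ / σ * (M : ℝ) ^ (-σ) := by
  have main : ∀ σ : ℝ, 1 < σ →
      ‖riemannZeta (σ + t * Complex.I) - ∑ n ∈ Finset.Icc 1 M, 1 / (n : ℂ) ^ (σ + t * Complex.I)‖
      ≤ (M : ℝ) ^ (1 - σ) / ‖(σ + t * Complex.I : ℂ) - 1‖
        + ‖(σ + t * Complex.I : ℂ)‖ / σ * (M : ℝ) ^ (-σ) := by
    intro σ hσ
    have := norm_riemannZeta_sub_sum_le_of_one_lt (s := σ + t * Complex.I) (by simpa using hσ) hM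
    simpa using this
  rcases hσ.lt_or_eq with h | rfl
  · exact main σ h
  have hM' : (M : ℝ) ≠ 0 := by exact_mod_cast hM.ne'
  have hne : ((1 : ℝ) + t * Complex.I : ℂ) ≠ 1 := by
    intro h
    have := congrArg Complex.im h
    simp at this
    exact ht this
  have hc : Continuous fun σ : ℝ => (σ + t * Complex.I : ℂ) := by fun_prop
  have hl : ContinuousAt (fun σ : ℝ => ‖riemannZeta (σ + t * Complex.I)
      - ∑ n ∈ Finset.Icc 1 M, 1 / (n : ℂ) ^ (σ + t * Complex.I)‖) 1 := by
    refine ContinuousAt.norm (ContinuousAt.sub ?_ ?_)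
    · exact ContinuousAt.comp (f := fun σ : ℝ => (σ + t * Complex.I : ℂ))
        (differentiableAt_riemannZeta hne).continuousAt hc.continuousAt
    · refine tendsto_finsetSum _ fun n hn => ?_
      have hn0 : (n : ℂ) ≠ 0 := by
        have := (Finset.mem_Icc.1 hn).1
        exact_mod_cast (by omega : n ≠ 0)
      exact ContinuousAt.div continuousAt_const
        (hc.continuousAt.const_cpow (Or.inl hn0)) (by simp [Complex.cpow_eq_zero_iff, hn0])
  have hr : ContinuousAt (fun σ : ℝ => (M : ℝ) ^ (1 - σ) / ‖(σ + t * Complex.I : ℂ) - 1‖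
        + ‖(σ + t * Complex.I : ℂ)‖ / σ * (M : ℝ) ^ (-σ)) 1 := by
    refine ContinuousAt.add (ContinuousAt.div ?_ (by fun_prop) ?_) (ContinuousAt.mul ?_ ?_)
    · exact ContinuousAt.rpow continuousAt_const (by fun_prop) (Or.inl hM')
    · simpa [sub_eq_zero] using hne
    · exact ContinuousAt.div (by fun_prop) continuousAt_id one_ne_zero
    · exact ContinuousAt.rpow continuousAt_const (by fun_prop) (Or.inl hM')
  have hl' := hl.mono_left (nhdsWithin_le_nhds (s := Set.Ioi (1 : ℝ)))
  have hr' := hr.mono_left (nhdsWithin_le_nhds (s := Set.Ioi (1 : ℝ)))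
  exact le_of_tendsto_of_tendsto hl' hr'
    (eventually_nhdsWithin_of_forall fun σ hσ => main σ hσ)

/-- Approximation of `ζ` by its partial sums up to a real `x`. -/
lemma norm_riemannZeta_sub_sum_floor_le {σ t x : ℝ} (hσ : 1 ≤ σ) (ht : 0 < t) (hx : 0 < x) :
    ‖riemannZeta (σ + t * Complex.I)
        - ∑ n ∈ Finset.Icc 1 ⌊x⌋₊, 1 / (n : ℂ) ^ (σ + t * Complex.I)‖
      ≤ (2 + t) * x ^ (-σ) + x ^ (1 - σ) / t := by
  -- The cut is made at `⌊x⌋₊ + 1 > x`, so negative powers of it are bounded by those of `x`.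
  -- Removing the last term costs one more `x ^ (-σ)`, whence `2 + t`.
  have h1 := norm_riemannZeta_sub_sum_le hσ ht.ne' (Nat.succ_pos ⌊x⌋₊)
  have hxM : x < ((⌊x⌋₊ + 1 : ℕ) : ℝ) := by exact_mod_cast Nat.lt_floor_add_one x
  have hM0 := hx.trans hxM
  rw [Nat.succ_eq_add_one, Finset.sum_Icc_succ_top (by omega)] at h1
  have h2 : ‖1 / ((⌊x⌋₊ + 1 : ℕ) : ℂ) ^ (σ + t * Complex.I)‖
      = ((⌊x⌋₊ + 1 : ℕ) : ℝ) ^ (-σ) := by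
    rw [norm_div, norm_one, ← Complex.ofReal_natCast, Complex.norm_cpow_eq_rpow_re_of_pos hM0,
      Real.rpow_neg hM0.le]
    simp
  have h3 : ‖(σ + t * Complex.I : ℂ)‖ / σ ≤ 1 + t := by
    rw [div_le_iff₀ (by linarith)]
    refine (norm_add_le _ _).trans ?_
    rw [norm_mul, Complex.norm_I, Complex.norm_real, Complex.norm_real,
      Real.norm_of_nonneg (by linarith), Real.norm_of_nonneg ht.le]
    nlinarith
  have h4 : t ≤ ‖(σ + t * Complex.I : ℂ) - 1‖ := by
    have := Complex.abs_im_le_norm ((σ + t * Complex.I : ℂ) - 1)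
    simpa [abs_of_pos ht] using this
  generalize ((⌊x⌋₊ + 1 : ℕ) : ℝ) = m at *
  have h5 : m ^ (-σ) ≤ x ^ (-σ) := Real.rpow_le_rpow_of_nonpos hx hxM.le (by linarith)
  have h6 : m ^ (1 - σ) ≤ x ^ (1 - σ) := Real.rpow_le_rpow_of_nonpos hx hxM.le (by linarith)
  have h7 : m ^ (1 - σ) / ‖(σ + t * Complex.I : ℂ) - 1‖ ≤ x ^ (1 - σ) / t := by gcongr
  have h8 : ‖(σ + t * Complex.I : ℂ)‖ / σ * m ^ (-σ) ≤ (1 + t) * x ^ (-σ) := by gcongr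
  have h9 := norm_add_le_of_le h1 h2.le
  rw [← sub_sub, sub_add_cancel] at h9
  linarith

/-! ### Partial summation and dyadic decomposition. -/

/-- Abel's inequality. -/
lemma norm_sum_mul_le_of_antitone {c : ℕ → ℝ} {z : ℕ → ℂ} {M N : ℕ} {B : ℝ} (hB : 0 ≤ B)
    (hc : ∀ n, M ≤ n → n < N → 0 ≤ c n) (hc0 : 0 ≤ c M)
    (hanti : ∀ n, M ≤ n → n + 1 < N → c (n + 1) ≤ c n)
    (hz : ∀ N', N' ≤ N → ‖∑ n ∈ Finset.Ico M N', z n‖ ≤ B) :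
    ‖∑ n ∈ Finset.Ico M N, (c n : ℂ) * z n‖ ≤ c M * B := by
  have key : ∀ m, M ≤ m → m < N → ‖∑ n ∈ Finset.Ico M (m + 1), (c n : ℂ) * z n
      - c m * ∑ n ∈ Finset.Ico M (m + 1), z n‖ ≤ (c M - c m) * B := by
    intro m hm
    induction m, hm using Nat.le_induction with
    | base => intro; simp
    | succ m hm ih =>
      intro h
      have h1 := ih (by omega)
      have h2 : ‖((c m - c (m + 1) : ℝ) : ℂ) * ∑ n ∈ Finset.Ico M (m + 1), z n‖
          ≤ (c m - c (m + 1)) * B := by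
        have := hanti m hm h
        rw [norm_mul, Complex.norm_real, Real.norm_of_nonneg (by linarith)]
        exact mul_le_mul_of_nonneg_left (hz _ h.le) (by linarith)
      refine le_trans (le_of_eq ?_) ((norm_add_le_of_le h1 h2).trans (le_of_eq (by ring)))
      rw [Finset.sum_Ico_succ_top (by omega : M ≤ m + 1) (fun n => (c n : ℂ) * z n),
        Finset.sum_Ico_succ_top (by omega : M ≤ m + 1) z]
      congr 1
      push_cast
      ring
  rcases le_or_gt N M with h | h
  · rw [Finset.Ico_eq_empty_of_le h]
    simpa using mul_nonneg hc0 hB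
  · obtain ⟨m, rfl⟩ : ∃ m, N = m + 1 := ⟨N - 1, by omega⟩
    have h1 := key m (by omega) (by omega)
    have h2 : ‖(c m : ℂ) * ∑ n ∈ Finset.Ico M (m + 1), z n‖ ≤ c m * B := by
      have := hc m (by omega) (by omega)
      rw [norm_mul, Complex.norm_real, Real.norm_of_nonneg this]
      exact mul_le_mul_of_nonneg_left (hz _ le_rfl) this
    have h3 := norm_add_le_of_le h1 h2
    rw [sub_add_cancel] at h3
    linarith

lemma one_div_cpow_eq_mul_phase (σ T : ℝ) {n : ℕ} (hn : 0 < n) :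
    1 / (n : ℂ) ^ ((σ : ℂ) + ((2 * Real.pi * T : ℝ) : ℂ) * Complex.I)
      = (((n : ℝ) ^ (-σ) : ℝ) : ℂ) * phase (-(T * Real.log n)) := by
  have hn0 : (n : ℂ) ≠ 0 := by exact_mod_cast hn.ne'
  rw [Complex.ofReal_cpow (Nat.cast_nonneg n), Complex.ofReal_natCast, one_div, ← Complex.cpow_neg,
    neg_add, Complex.cpow_add _ _ hn0, Complex.ofReal_neg]
  congr 1
  rw [Complex.cpow_def_of_ne_zero hn0, ← Complex.natCast_log]
  unfold phase
  congr 1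
  push_cast
  ring

/-- Partial summation over a dyadic block. -/
lemma norm_sum_one_div_cpow_le {σ T y B : ℝ} (hσ : 0 ≤ σ) (hy : 0 < y) {M N : ℕ} (hM : y < M)
    (hN : (N : ℝ) ≤ 2 * y + 1) (hB : ∀ N' : ℕ, (N' : ℝ) ≤ 2 * y + 1 →
      ‖∑ n ∈ Finset.Ico M N', phase (-(T * Real.log n))‖ ≤ B) :
    ‖∑ n ∈ Finset.Ico M N, 1 / (n : ℂ) ^ ((σ : ℂ) + ((2 * Real.pi * T : ℝ) : ℂ) * Complex.I)‖
      ≤ y ^ (-σ) * B := by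
  have hM0 : 0 < M := by exact_mod_cast hy.trans hM
  have hB0 : 0 ≤ B := (norm_nonneg _).trans (hB N hN)
  rw [Finset.sum_congr rfl fun n hn => one_div_cpow_eq_mul_phase σ T
    (hM0.trans_le (Finset.mem_Ico.1 hn).1)]
  refine (norm_sum_mul_le_of_antitone (c := fun n => (n : ℝ) ^ (-σ)) hB0
    (fun n _ _ => by positivity) (by positivity) ?_ ?_).trans ?_
  · intro n hn _
    have : (0 : ℝ) < n := by exact_mod_cast hM0.trans_le hn
    exact Real.rpow_le_rpow_of_nonpos this (by push_cast; linarith) (by linarith)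
  · intro N' hN'
    exact hB N' (le_trans (by exact_mod_cast hN') hN)
  · exact mul_le_mul_of_nonneg_right
      (Real.rpow_le_rpow_of_nonpos hy hM.le (by linarith)) hB0

/-- Summation over dyadic blocks: `b` bounds a block, `G k` bounds the sum over `k` blocks. -/
lemma norm_sum_le_of_dyadic {g : ℕ → ℂ} {b : ℝ → ℝ} {G : ℕ → ℝ → ℝ} {x₀ X : ℝ} (hx₀ : 0 < x₀)
    (hb : ∀ y z, x₀ ≤ y → y ≤ z → z ≤ X → z ≤ 2 * y →
      ‖∑ n ∈ Finset.Ico (⌊y⌋₊ + 1) (⌊z⌋₊ + 1), g n‖ ≤ b y)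
    (hG : ∀ k y, x₀ ≤ y → 0 ≤ G k y)
    (hbG : ∀ k y, x₀ ≤ y → b y + G k (2 * y) ≤ G (k + 1) y) (k : ℕ) :
    ∀ x, x₀ ≤ x → x ≤ X → X ≤ 2 ^ k * x →
      ‖∑ n ∈ Finset.Ico (⌊x⌋₊ + 1) (⌊X⌋₊ + 1), g n‖ ≤ G k x := by
  induction k with
  | zero =>
    intro x hx hxX hX
    obtain rfl : x = X := le_antisymm hxX (by simpa using hX)
    simpa using hG 0 x hx
  | succ k ih =>
    intro x hx hxX hX
    have h0 := hbG k x hx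
    rcases le_total X (2 * x) with h | h
    · linarith [hb x X hx hxX le_rfl h, hG k (2 * x) (by linarith)]
    · have h1 := hb x (2 * x) hx (by linarith) h le_rfl
      have h2 := ih (2 * x) (by linarith) h (by rw [pow_succ] at hX; linarith)
      have h3 : ⌊x⌋₊ ≤ ⌊2 * x⌋₊ := Nat.floor_le_floor (by linarith)
      have h4 : ⌊2 * x⌋₊ ≤ ⌊X⌋₊ := Nat.floor_le_floor h
      rw [← Finset.sum_Ico_consecutive g (Nat.succ_le_succ h3) (Nat.succ_le_succ h4)]
      linarith [norm_add_le_of_le h1 h2]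

/-! ### Numerical constants and the two ranges of the zeta sum. -/

lemma le_vanDerCorputA : 2.775 ≤ vanDerCorputA := by
  unfold vanDerCorputA
  have hp := Real.pi_pos
  have h1 : √Real.pi ≤ 1.7726 := by
    rw [Real.sqrt_le_left (by norm_num)]
    linarith [Real.pi_lt_d4]
  have h2 : 1.127 ≤ 2 / √Real.pi := by
    rw [le_div_iff₀ (Real.sqrt_pos.2 hp)]
    linarith
  have h3 : 1.648 ≤ √(4 / Real.pi + 3 / 2) := by
    apply Real.le_sqrt_of_sq_le
    have : 1.27 ≤ 4 / Real.pi := by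
      rw [le_div_iff₀ hp]
      linarith [Real.pi_lt_d4]
    linarith
  linarith

lemma le_vanDerCorputAHat3 : 11.4 ≤ vanDerCorputAHat3 := by
  unfold vanDerCorputAHat3
  have h1 : 1.68 ≤ (2 : ℝ) ^ (3 / 4 : ℝ) := by
    have e : ((1.68 : ℝ) ^ (4 : ℝ)) ^ (1 / 4 : ℝ) = 1.68 := by
      rw [← Real.rpow_mul (by norm_num)]
      norm_num
    have e2 : ((2 : ℝ) ^ (3 : ℝ)) ^ (1 / 4 : ℝ) = (2 : ℝ) ^ (3 / 4 : ℝ) := by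
      rw [← Real.rpow_mul (by norm_num)]
      norm_num
    rw [← e, ← e2]
    apply Real.rpow_le_rpow (by positivity) _ (by norm_num)
    rw [show (4 : ℝ) = (4 : ℕ) by norm_num, show (3 : ℝ) = (3 : ℕ) by norm_num,
      Real.rpow_natCast, Real.rpow_natCast]
    norm_num
  have h2 : 1.414 ≤ √2 := by
    apply Real.le_sqrt_of_sq_le
    norm_num
  nlinarith

lemma cast_floor_add_one_le {y z : ℝ} (hz : 0 ≤ z) (h : z ≤ 2 * y) :
    ((⌊z⌋₊ + 1 : ℕ) : ℝ) ≤ 2 * y + 1 := by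
  push_cast
  linarith [Nat.floor_le hz]

/-- The part of the zeta sum estimated with the third derivative test. -/
lemma norm_sum_one_div_cpow_le_third {σ T x X : ℝ} (hσ : 1 ≤ σ) (hT : 20 < T) (hx : 1 ≤ x)
    (hxX : x ≤ X) (hX : X ≤ T ^ (2 / 3 : ℝ)) :
    ‖∑ n ∈ Finset.Ico (⌊x⌋₊ + 1) (⌊X⌋₊ + 1),
        1 / (n : ℂ) ^ ((σ : ℂ) + ((2 * Real.pi * T : ℝ) : ℂ) * Complex.I)‖
      ≤ vanDerCorputAHat3 * T ^ (1 / 6 : ℝ) * x ^ (-(σ - 1 / 2))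
        / (1 - (2 : ℝ) ^ (-(σ - 1 / 2))) := by
  have hT0 : 0 < T := by linarith
  set a := T ^ (1 / 6 : ℝ) with ha
  have ha0 : 0 < a := by positivity
  have ha6 : a ^ 6 = T := by
    rw [ha, ← Real.rpow_natCast, ← Real.rpow_mul hT0.le]
    norm_num
  have ha4 : T ^ (2 / 3 : ℝ) = (a ^ 2) ^ 2 := by
    rw [ha, ← pow_mul, ← Real.rpow_natCast, ← Real.rpow_mul hT0.le]
    norm_num
  -- This follows from `τ > 20`, as `1.6 ^ 6 < 17`.
  have ha16 : 1.6 ≤ a := by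
    by_contra! h
    have : a ^ 6 ≤ 1.6 ^ 6 := by gcongr
    rw [ha6] at this
    norm_num at this
    linarith
  have hA := le_vanDerCorputAHat3
  have hr : (2 : ℝ) ^ (-(σ - 1 / 2)) < 1 :=
    Real.rpow_lt_one_of_one_lt_of_neg (by norm_num) (by linarith)
  obtain ⟨k, hk⟩ := pow_unbounded_of_one_lt X (one_lt_two (α := ℝ))
  -- `G` is the full geometric series in `2 ^ (-(σ - 1/2))`, so it does not depend on the number of
  -- blocks and `b y + G (2y) = G y` exactly.
  refine norm_sum_le_of_dyadic (x₀ := 1) (b := fun y => vanDerCorputAHat3 * a * y ^ (-(σ - 1 / 2)))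
    (G := fun _ y => vanDerCorputAHat3 * a * y ^ (-(σ - 1 / 2)) / (1 - (2 : ℝ) ^ (-(σ - 1 / 2))))
    one_pos ?_ ?_ ?_ k x hx hxX (hk.le.trans (le_mul_of_one_le_right (by positivity) hx))
  · intro y z hy hyz hzX hzy
    have hy0 : 0 < y := by linarith
    have hw : √y ^ 2 = y := Real.sq_sqrt hy0.le
    have hw1 : 1 ≤ √y := Real.one_le_sqrt.2 hy
    have hwa : √y ≤ a ^ 2 := by
      rw [Real.sqrt_le_left (by positivity), ← ha4]
      linarith
    have hM : y < ((⌊y⌋₊ + 1 : ℕ) : ℝ) := by exact_mod_cast Nat.lt_floor_add_one y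
    refine (norm_sum_one_div_cpow_le (B := 11.4 * a * √y) (by linarith) hy0 hM
      (cast_floor_add_one_le (by linarith) hzy) ?_).trans ?_
    · intro N' hN'
      rw [← ha6]
      exact norm_sum_phase_log_le_third ha16 hw1 hwa (by rwa [hw]) (by rwa [hw])
    · have e : y ^ (-(σ - 1 / 2)) = y ^ (-σ) * √y := by
        rw [Real.sqrt_eq_rpow, ← Real.rpow_add hy0]
        ring_nf
      rw [e]
      have : 0 ≤ a * (y ^ (-σ) * √y) := by positivity
      nlinarith
  · intro _ y hy
    have : 0 < y := by linarith
    exact div_nonneg (by positivity) (by linarith)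
  · intro _ y hy
    have : 0 < y := by linarith
    rw [Real.mul_rpow (by norm_num) this.le]
    apply le_of_eq
    have : 1 - (2 : ℝ) ^ (-(σ - 1 / 2)) ≠ 0 := by linarith
    generalize (2 : ℝ) ^ (-(σ - 1 / 2)) = r at *
    field_simp
    ring

/-- The part of the zeta sum estimated with the second derivative test. -/
lemma norm_sum_one_div_cpow_le_second {σ T x X : ℝ} (hσ : 1 ≤ σ) (hT : 20 < T)
    (hx : T ^ (2 / 3 : ℝ) ≤ x) (hxX : x ≤ X) {k : ℕ} (hk : X ≤ 2 ^ k * x) :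
    ‖∑ n ∈ Finset.Ico (⌊x⌋₊ + 1) (⌊X⌋₊ + 1),
        1 / (n : ℂ) ^ ((σ : ℂ) + ((2 * Real.pi * T : ℝ) : ℂ) * Complex.I)‖
      ≤ 4 * vanDerCorputA * √T * x ^ (-σ) / (1 - (2 : ℝ) ^ (-σ))
        + k * (4 * vanDerCorputA * (x ^ (1 - σ) / √T)) := by
  have hT0 : 0 < T := by linarith
  have hA := le_vanDerCorputA
  have hA0 : 0 ≤ vanDerCorputA := by linarith
  have hs : 0 < √T := Real.sqrt_pos.2 hT0
  have hsq : √T ^ 2 = T := Real.sq_sqrt hT0.le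
  have hr : (2 : ℝ) ^ (-σ) < 1 :=
    Real.rpow_lt_one_of_one_lt_of_neg (by norm_num) (by linarith)
  have hx₀ : 0 < T ^ (2 / 3 : ℝ) := by positivity
  -- The part `√T * y ^ (-σ)` of the block bound sums geometrically. The part `y ^ (1 - σ) / √T`
  -- need not decay, since `σ = 1` is allowed, so it is counted once per block; this is the source
  -- of the logarithm.
  refine norm_sum_le_of_dyadic (x₀ := T ^ (2 / 3 : ℝ))
    (b := fun y => y ^ (-σ) * (4 * vanDerCorputA * (√T + y / √T)))
    (G := fun k y => 4 * vanDerCorputA * √T * y ^ (-σ) / (1 - (2 : ℝ) ^ (-σ))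
        + k * (4 * vanDerCorputA * (y ^ (1 - σ) / √T)))
    hx₀ ?_ ?_ ?_ k x hx hxX hk
  · intro y z hy hyz hzX hzy
    have hy0 : 0 < y := hx₀.trans_le hy
    have hM : y < ((⌊y⌋₊ + 1 : ℕ) : ℝ) := by exact_mod_cast Nat.lt_floor_add_one y
    refine norm_sum_one_div_cpow_le (by linarith) hy0 hM
      (cast_floor_add_one_le (by linarith) hzy) ?_
    intro N' hN'
    refine (norm_sum_phase_log_le hT0 hy0 hM hN').trans ?_
    have hTy : T / y ≤ √T := by
      have h1 : √T ≤ y := by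
        refine le_trans ?_ hy
        rw [Real.sqrt_eq_rpow]
        exact Real.rpow_le_rpow_of_exponent_le (by linarith) (by norm_num)
      rw [div_le_iff₀ hy0]
      nlinarith
    have hs4 : 4 ≤ √T := by
      apply Real.le_sqrt_of_sq_le
      linarith
    have e : (T / y + 2) * (4.6 * y / √T + 1) = 4.6 * √T + 9.2 * (y / √T) + T / y + 2 := by
      generalize √T = r at *
      rw [← hsq]
      field_simp
      ring
    rw [e]
    have : 0 < y / √T := by positivity
    nlinarith
  · intro k y hy
    have : 0 < y := hx₀.trans_le hy
    exact add_nonneg (div_nonneg (by positivity) (by linarith)) (by positivity)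
  · intro k y hy
    have hy0 : 0 < y := hx₀.trans_le hy
    have h1 : (2 * y) ^ (1 - σ) ≤ y ^ (1 - σ) :=
      Real.rpow_le_rpow_of_nonpos hy0 (by linarith) (by linarith)
    have h2 : y ^ (-σ) * y = y ^ (1 - σ) := by
      nth_rewrite 2 [← Real.rpow_one y]
      rw [← Real.rpow_add hy0]
      ring_nf
    have h3 : (k : ℝ) * (4 * vanDerCorputA * ((2 * y) ^ (1 - σ) / √T))
        ≤ k * (4 * vanDerCorputA * (y ^ (1 - σ) / √T)) := by gcongr
    have h4 : y ^ (-σ) * (4 * vanDerCorputA * (√T + y / √T))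
        = 4 * vanDerCorputA * √T * y ^ (-σ) + 4 * vanDerCorputA * (y ^ (1 - σ) / √T) := by
      rw [← h2]
      ring
    have h5 : 4 * vanDerCorputA * √T * y ^ (-σ)
        + 4 * vanDerCorputA * √T * ((2 : ℝ) ^ (-σ) * y ^ (-σ)) / (1 - (2 : ℝ) ^ (-σ))
        = 4 * vanDerCorputA * √T * y ^ (-σ) / (1 - (2 : ℝ) ^ (-σ)) := by
      have : 1 - (2 : ℝ) ^ (-σ) ≠ 0 := by linarith
      field_simp
      ring
    rw [Real.mul_rpow (by norm_num : (0 : ℝ) ≤ 2) hy0.le (z := -σ), h4]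
    push_cast
    linarith

theorem mainTheorem5 (σ t τ : ℝ) (hτ : τ = t / (2 * Real.pi)) (hτ20 : 20 < τ) (hσ : 1 ≤ σ) :
    ‖riemannZeta ((σ : ℂ) + (t : ℂ) * Complex.I)
        - ∑ n ∈ Finset.Icc 1 ⌊τ ^ (1 / 2 : ℝ)⌋₊, 1 / (n : ℂ) ^ ((σ : ℂ) + (t : ℂ) * Complex.I)‖
      ≤ vanDerCorputAHat3 * (2 : ℝ) ^ (σ - 1 / 2) / ((2 : ℝ) ^ (σ - 1 / 2) - 1)
            * τ ^ ((1 / 2 : ℝ) * (5 / 6 - σ))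
        + (2 : ℝ) ^ (σ + 1) * vanDerCorputA / (1 - (2 : ℝ) ^ (-σ))
            * τ ^ ((2 / 3 : ℝ) * (3 / 4 - σ))
        + (2 : ℝ) ^ (σ + 3) * vanDerCorputA / (3 * Real.log 2)
            * τ ^ ((2 / 3 : ℝ) * (1 / 4 - σ)) * Real.log τ
        + (2 : ℝ) ^ (σ + 1) * vanDerCorputA * τ ^ ((2 / 3 : ℝ) * (1 / 4 - σ))
        + 8 * τ ^ (2 * (1 / 2 - σ)) := by
  have hp := Real.pi_pos
  have hτ0 : 0 < τ := by linarith
  have hτ1 : 1 ≤ τ := by linarith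
  obtain rfl : t = 2 * Real.pi * τ := by rw [hτ]; field_simp
  have hA : 0 ≤ vanDerCorputA := by linarith [le_vanDerCorputA]
  have hr : (2 : ℝ) ^ (-σ) < 1 :=
    Real.rpow_lt_one_of_one_lt_of_neg (by norm_num) (by linarith)
  have h2σ : (4 : ℝ) ≤ 2 ^ (σ + 1) := by
    calc (4 : ℝ) = 2 ^ (2 : ℝ) := by norm_num
      _ ≤ 2 ^ (σ + 1) := Real.rpow_le_rpow_of_exponent_le (by norm_num) (by linarith)
  have hlog2 : 0 < Real.log 2 := Real.log_pos one_lt_two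
  have hlog : 0 < Real.log τ := Real.log_pos (by linarith)
  have hord1 : τ ^ (1 / 2 : ℝ) ≤ τ ^ (2 / 3 : ℝ) :=
    Real.rpow_le_rpow_of_exponent_le hτ1 (by norm_num)
  have hord2 : τ ^ (2 / 3 : ℝ) ≤ τ ^ (2 : ℝ) :=
    Real.rpow_le_rpow_of_exponent_le hτ1 (by norm_num)
  have htail := norm_riemannZeta_sub_sum_floor_le (x := τ ^ (2 : ℝ)) hσ
    (show 0 < 2 * Real.pi * τ by positivity) (by positivity)
  have hthird := norm_sum_one_div_cpow_le_third hσ hτ20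
    (Real.one_le_rpow hτ1 (by norm_num)) hord1 le_rfl
  -- The number of doublings from `τ ^ (2/3)` to `τ ^ 2`. The `+ 1` from rounding up produces the
  -- term of the bound with `τ ^ ((2/3)(1/4 - σ))` and no logarithm.
  set k := ⌈4 / 3 * (Real.log τ / Real.log 2)⌉₊ with hk
  have hkle : (k : ℝ) ≤ 4 / 3 * (Real.log τ / Real.log 2) + 1 :=
    (Nat.ceil_lt_add_one (by positivity)).le
  have hkX : τ ^ (2 : ℝ) ≤ 2 ^ k * τ ^ (2 / 3 : ℝ) := by
    have h1 : τ ^ (4 / 3 : ℝ) ≤ 2 ^ k := by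
      rw [← Real.rpow_natCast, Real.rpow_def_of_pos hτ0, Real.rpow_def_of_pos two_pos,
        Real.exp_le_exp]
      have := Nat.le_ceil (4 / 3 * (Real.log τ / Real.log 2))
      rw [← hk, ← mul_div_assoc, div_le_iff₀ hlog2] at this
      linarith
    calc τ ^ (2 : ℝ) = τ ^ (4 / 3 : ℝ) * τ ^ (2 / 3 : ℝ) := by
          rw [← Real.rpow_add hτ0]; norm_num
      _ ≤ _ := by gcongr
  have hsecond := norm_sum_one_div_cpow_le_second hσ hτ20 le_rfl hord2 hkX
  set g : ℕ → ℂ := fun n => 1 / (n : ℂ) ^ ((σ : ℂ) + ((2 * Real.pi * τ : ℝ) : ℂ) * Complex.I)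
    with hg
  have hsplit : ∑ n ∈ Finset.Icc 1 ⌊τ ^ (2 : ℝ)⌋₊, g n
      = ∑ n ∈ Finset.Icc 1 ⌊τ ^ (1 / 2 : ℝ)⌋₊, g n
        + ∑ n ∈ Finset.Ico (⌊τ ^ (1 / 2 : ℝ)⌋₊ + 1) (⌊τ ^ (2 / 3 : ℝ)⌋₊ + 1), g n
        + ∑ n ∈ Finset.Ico (⌊τ ^ (2 / 3 : ℝ)⌋₊ + 1) (⌊τ ^ (2 : ℝ)⌋₊ + 1), g n := by
    have f1 := Nat.floor_le_floor hord1
    have f2 := Nat.floor_le_floor hord2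
    change ∑ n ∈ Finset.Ico 1 (⌊τ ^ (2 : ℝ)⌋₊ + 1), g n
      = ∑ n ∈ Finset.Ico 1 (⌊τ ^ (1 / 2 : ℝ)⌋₊ + 1), g n + _ + _
    rw [Finset.sum_Ico_consecutive g (by omega) (by omega),
      Finset.sum_Ico_consecutive g (by omega) (by omega)]
  have b1 : vanDerCorputAHat3 * τ ^ (1 / 6 : ℝ) * (τ ^ (1 / 2 : ℝ)) ^ (-(σ - 1 / 2))
        / (1 - (2 : ℝ) ^ (-(σ - 1 / 2)))
      = vanDerCorputAHat3 * (2 : ℝ) ^ (σ - 1 / 2) / ((2 : ℝ) ^ (σ - 1 / 2) - 1)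
            * τ ^ ((1 / 2 : ℝ) * (5 / 6 - σ)) := by
    have e : τ ^ ((1 / 2 : ℝ) * (5 / 6 - σ))
        = τ ^ (1 / 6 : ℝ) * (τ ^ (1 / 2 : ℝ)) ^ (-(σ - 1 / 2)) := by
      rw [← Real.rpow_mul hτ0.le, ← Real.rpow_add hτ0]
      ring_nf
    have h1 : 1 < (2 : ℝ) ^ (σ - 1 / 2) := Real.one_lt_rpow one_lt_two (by linarith)
    rw [e, Real.rpow_neg two_pos.le (σ - 1 / 2)]
    have h2 : (2 : ℝ) ^ (σ - 1 / 2) - 1 ≠ 0 := by linarith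
    have h3 : (2 : ℝ) ^ (σ - 1 / 2) ≠ 0 := by linarith
    have h4 : 1 - ((2 : ℝ) ^ (σ - 1 / 2))⁻¹ = ((2 : ℝ) ^ (σ - 1 / 2) - 1) / 2 ^ (σ - 1 / 2) := by
      field_simp
    rw [h4]
    field_simp
  have b2 : 4 * vanDerCorputA * √τ * (τ ^ (2 / 3 : ℝ)) ^ (-σ) / (1 - (2 : ℝ) ^ (-σ))
      ≤ (2 : ℝ) ^ (σ + 1) * vanDerCorputA / (1 - (2 : ℝ) ^ (-σ))
            * τ ^ ((2 / 3 : ℝ) * (3 / 4 - σ)) := by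
    have e : τ ^ ((2 / 3 : ℝ) * (3 / 4 - σ)) = √τ * (τ ^ (2 / 3 : ℝ)) ^ (-σ) := by
      rw [Real.sqrt_eq_rpow, ← Real.rpow_mul hτ0.le, ← Real.rpow_add hτ0]
      ring_nf
    rw [e, div_mul_eq_mul_div, ← mul_assoc]
    have : 0 < 1 - (2 : ℝ) ^ (-σ) := by linarith
    gcongr
  have b3 : (k : ℝ) * (4 * vanDerCorputA * ((τ ^ (2 / 3 : ℝ)) ^ (1 - σ) / √τ))
      ≤ (2 : ℝ) ^ (σ + 3) * vanDerCorputA / (3 * Real.log 2)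
            * τ ^ ((2 / 3 : ℝ) * (1 / 4 - σ)) * Real.log τ
        + (2 : ℝ) ^ (σ + 1) * vanDerCorputA * τ ^ ((2 / 3 : ℝ) * (1 / 4 - σ)) := by
    have e : (τ ^ (2 / 3 : ℝ)) ^ (1 - σ) / √τ = τ ^ ((2 / 3 : ℝ) * (1 / 4 - σ)) := by
      rw [Real.sqrt_eq_rpow, ← Real.rpow_mul hτ0.le, ← Real.rpow_sub hτ0]
      ring_nf
    have e2 : (2 : ℝ) ^ (σ + 3) = 2 ^ (σ + 1) * 4 := by
      rw [show σ + 3 = σ + 1 + 2 by ring, Real.rpow_add two_pos]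
      norm_num
    rw [e, e2]
    calc (k : ℝ) * (4 * vanDerCorputA * τ ^ ((2 / 3 : ℝ) * (1 / 4 - σ)))
        ≤ (4 / 3 * (Real.log τ / Real.log 2) + 1)
          * (2 ^ (σ + 1) * vanDerCorputA * τ ^ ((2 / 3 : ℝ) * (1 / 4 - σ))) := by gcongr
      _ = _ := by
        field_simp
  -- With cutoff `τ ^ 2` the constant is `2π + 2/τ + 1/(2π)`, which is below 8.
  have b4 : (2 + 2 * Real.pi * τ) * (τ ^ (2 : ℝ)) ^ (-σ)
        + (τ ^ (2 : ℝ)) ^ (1 - σ) / (2 * Real.pi * τ) ≤ 8 * τ ^ (2 * (1 / 2 - σ)) := by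
    have e1 : (τ ^ (2 : ℝ)) ^ (-σ) = τ ^ (2 * (1 / 2 - σ)) / τ := by
      rw [← Real.rpow_mul hτ0.le, ← Real.rpow_sub_one hτ0.ne']
      ring_nf
    have e2 : (τ ^ (2 : ℝ)) ^ (1 - σ) = τ ^ (2 * (1 / 2 - σ)) * τ := by
      rw [← Real.rpow_mul hτ0.le, ← Real.rpow_add_one hτ0.ne']
      ring_nf
    have hE : 0 < τ ^ (2 * (1 / 2 - σ)) := by positivity
    rw [e1, e2]
    generalize τ ^ (2 * (1 / 2 - σ)) = E at *
    have e3 : (2 + 2 * Real.pi * τ) * (E / τ) + E * τ / (2 * Real.pi * τ)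
        = (2 / τ + 2 * Real.pi + 1 / (2 * Real.pi)) * E := by
      field_simp
    rw [e3]
    have i1 : 2 / τ ≤ 0.1 := by
      rw [div_le_iff₀ hτ0]
      linarith
    have i2 : 1 / (2 * Real.pi) ≤ 0.2 := by
      rw [div_le_iff₀ (by positivity)]
      linarith [Real.pi_gt_three]
    gcongr
    linarith [Real.pi_lt_d2]
  have hfin := norm_add_le_of_le (norm_add_le_of_le htail hthird) hsecond
  rw [hsplit] at hfin
  have heq : riemannZeta ((σ : ℂ) + ((2 * Real.pi * τ : ℝ) : ℂ) * Complex.I)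
      - ∑ n ∈ Finset.Icc 1 ⌊τ ^ (1 / 2 : ℝ)⌋₊, g n
      = riemannZeta ((σ : ℂ) + ((2 * Real.pi * τ : ℝ) : ℂ) * Complex.I)
        - (∑ n ∈ Finset.Icc 1 ⌊τ ^ (1 / 2 : ℝ)⌋₊, g n
        + ∑ n ∈ Finset.Ico (⌊τ ^ (1 / 2 : ℝ)⌋₊ + 1) (⌊τ ^ (2 / 3 : ℝ)⌋₊ + 1), g n
        + ∑ n ∈ Finset.Ico (⌊τ ^ (2 / 3 : ℝ)⌋₊ + 1) (⌊τ ^ (2 : ℝ)⌋₊ + 1), g n)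
        + ∑ n ∈ Finset.Ico (⌊τ ^ (1 / 2 : ℝ)⌋₊ + 1) (⌊τ ^ (2 / 3 : ℝ)⌋₊ + 1), g n
        + ∑ n ∈ Finset.Ico (⌊τ ^ (2 / 3 : ℝ)⌋₊ + 1) (⌊τ ^ (2 : ℝ)⌋₊ + 1), g n := by ring
  rw [heq]
  linarith
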